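/- Let $m\ge 1$ and let $S$ be a toric Sasaki manifold of dimension $2m-1$: a Riemannian manifold $(S,g)$ with a complex structure $J$ on the cone $C(S)=S\times\mathbb{R}^{+}$ such that $(C(S),\overline g=r^{2}g+dr^{2},J)$ is Kähler, with Kähler form $\omega=\overline g(J\cdot,\cdot)$, and an effective action of $T^{m}$ on $S$ whose induced action on $C(S)$ is holomorphic and isometric. Let $\mathfrak g=\mathbb{R}^{m}$ be the Lie algebra of $T^m$, with exponential map $\exp(v)=(e^{iv^{1}},\dots,e^{iv^{m}})$, and assume that the Reeb field $J(r\,\partial/\partial r)$ is generated by an element of $\mathfrak g$. Regard $C(S)$ as the toric variety of a smooth fan, with a holomorphic action of $T^{m}_{\mathbb{C}}=(\mathbb{C}^{\times})^{m}$ extending that of $T^m$, and with open dense orbit $U_0\cong T^{m}_{\mathbb C}$ (identified by a base point) with logarithmic coordinates $z^{k}$. Let $\Lambda\subset\mathbb{Z}^{m}\subset\mathfrak g$ be the set of primitive generators of the rays of the fan, and let $\sigma$ be the anti-holomorphic involution of $C(S)$ that is complex conjugation on $U_0\cong T_{\mathbb C}^m$. Suppose that $\gamma\in\mathbb{Z}^{m}$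 satisfies $\langle\gamma,\lambda\rangle=1$ for all $\lambda\in\Lambda$, and let $\Omega_\gamma$ be the non-vanishing holomorphic $(m,0)$-form on $C(S)$ equal to $\exp(\gamma_1z^1+\dots+\gamma_mz^m)\,dz^1\wedge\dots\wedge dz^m$ on $U_0$. (Thus $(C(S),\omega,\Omega_\gamma)$ is a toric almost Calabi–Yau cone.) Let $\mu:C(S)\to\mathfrak g^{*}$ be the moment map $\langle\mu(p),v\rangle=\frac12 r^{2}(p)\,\eta(v(p))$, where $\eta=r^{-2}\,\overline g(J(r\,\partial/\partial r),\cdot)$ and $v(p)$ is the vector at $p$ of the field generated by $v$, and put $\Delta=\mu(C(S))$. Let $\zeta\in\mathfrak g$, $c\in\mathbb{R}$ and $H_{\zeta,c}=\{y\in\mathfrak g^*:\langle y,\zeta\rangle=c\}$, and assume that $\mathrm{Int}\,\Delta\cap H_{\zeta,c}\ne\emptyset$ and that $\zeta\notin\mathrm{Span}_{\mathbb R}\{\lambda\in\Lambda:\langle y,\lambda\rangle=0\}$ for every $y\in\Delta\cap H_{\zeta,c}$. Let $I\subset\mathbb{R}$ be a non-empty open interval, $f:I\to\mathbb{R}$ a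 smooth function with nowhere vanishing derivative, $\rho:I\to\mathbb{R}^{+}$ a function, and $\tau_0=(e^{i\nu^{1}},\dots,e^{i\nu^{m}})\in T^{m}$. Put $$C(S)^{\sigma}_{\zeta,c}=\{p\in C(S):\sigma(p)=p,\ \langle\mu(p),\zeta\rangle=c\},\qquad L_{\zeta,c}=C(S)^{\sigma}_{\zeta,c}\times I,$$ $$F:L_{\zeta,c}\to C(S),\qquad F(p,t)=\rho(t)\cdot\exp(f(t)\zeta)\cdot\tau_0\cdot p ,$$ where $\rho\cdot(s,r)=(s,\rho r)$, and let $N=\langle\zeta,\gamma\rangle=\sum_k\gamma_k\zeta^k$ and $\theta=\sum_k\gamma_k\nu^k$. Assume that $\rho$ is constant, and let $\theta_0\in\mathbb{R}$. Then $F:L_{\zeta,c}\to C(S)$ is a special Lagrangian submanifold with phase $e^{i\theta_0}$, that is, $C(S)^\sigma_{\zeta,c}$ is an embedded submanifold of dimension $m-1$ and $F$ is a Lagrangian immersion whose Lagrangian angle (the argument modulo $\pi$ of $F^{*}\Omega_\gamma$ evaluated on bases of the tangent spaces of $L_{\zeta,c}$) is identically equal to $\theta_0$ modulo $\pi$, if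 and only if $$N=0\quad\text{and}\quad \theta+\frac{\pi}{2}\equiv\theta_0 \pmod{\pi}.$$ -/

import Mathlib

open scoped Manifold ContDiff

noncomputable section

namespace ToricCone

/-! ### Cones over odd-dimensional Riemannian manifolds -/

/-- The manifold `ℝ⁺` of positive real numbers. -/
abbrev PosReal : TopologicalSpace.Opens ℝ := ⟨Set.Ioi 0, isOpen_Ioi⟩

/-- The cone `C(S) = S × ℝ⁺` (without apex). -/
abbrev Cone (S : Type*) : Type _ := S × PosReal

/-- The model vector space of the `2m`-dimensional manifold `C(S)`, where `dim S = 2m - 1`. -/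
abbrev ConeE (m : ℕ) : Type := EuclideanSpace ℝ (Fin (2 * m - 1)) × ℝ

/-- The model with corners of `C(S)`, where `dim S = 2m - 1`. -/
abbrev coneI (m : ℕ) :
    ModelWithCorners ℝ (ConeE m) (ModelProd (EuclideanSpace ℝ (Fin (2 * m - 1))) ℝ) :=
  (𝓡 (2 * m - 1)).prod 𝓘(ℝ, ℝ)

section Basic

variable {m : ℕ} {S : Type*} [TopologicalSpace S]
  [ChartedSpace (EuclideanSpace ℝ (Fin (2 * m - 1))) S]

/-- The tangent space `T_p C(S) = T_s S × ℝ` at `p = (s, r)`. -/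
abbrev ConeTangent (m : ℕ) {S : Type*} [TopologicalSpace S]
    [ChartedSpace (EuclideanSpace ℝ (Fin (2 * m - 1))) S] (p : Cone S) : Type :=
  TangentSpace (coneI m) p

/-- The `ℝ⁺`-action `ρ · (s, r) = (s, ρ r)` on the cone. -/
def dil {S : Type*} (a : PosReal) (p : Cone S) : Cone S :=
  (p.1, ⟨(a : ℝ) * (p.2 : ℝ), Set.mem_Ioi.2 (mul_pos (Set.mem_Ioi.1 a.2) (Set.mem_Ioi.1 p.2.2))⟩)

/-- The position vector `r ∂/∂r` at `p = (s, r)`. -/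
def radial (p : Cone S) : ConeTangent m p := ((0 : EuclideanSpace ℝ (Fin (2 * m - 1))), (p.2 : ℝ))

/-- The cone metric `r² g + dr²`; the two components of a tangent vector of
`S × ℝ⁺` are its images under the differentials of the two projections. -/
def coneMetric [IsManifold (𝓡 (2 * m - 1)) ∞ S]
    (g : Bundle.ContMDiffRiemannianMetric (𝓡 (2 * m - 1)) ∞ (EuclideanSpace ℝ (Fin (2 * m - 1)))
      (fun s : S => TangentSpace (𝓡 (2 * m - 1)) s))
    (p : Cone S) (v w : ConeTangent m p) : ℝ :=
  (p.2 : ℝ) ^ 2 * g.inner p.1 v.1 w.1 + v.2 * w.2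

/-- `d om = 0` for a field of alternating bilinear forms `om` on `C(S)`: in each chart,
`∂_a om(b, c) + ∂_b om(c, a) + ∂_c om(a, b)` vanishes for constant `a, b, c`. -/
def IsClosedTwoForm (om : (p : Cone S) → ConeTangent m p → ConeTangent m p → ℝ) : Prop :=
  ∀ p₀ : Cone S, ∀ y ∈ (extChartAt (coneI m) p₀).target, ∀ a b c : ConeE m,
    let W : ConeE m → ConeE m → ConeE m → ℝ := fun u v x =>
      om ((extChartAt (coneI m) p₀).symm x)
        (mfderiv 𝓘(ℝ, ConeE m) (coneI m) (extChartAt (coneI m) p₀).symm x u)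
        (mfderiv 𝓘(ℝ, ConeE m) (coneI m) (extChartAt (coneI m) p₀).symm x v)
    fderiv ℝ (W b c) y a + fderiv ℝ (W c a) y b + fderiv ℝ (W a b) y c = 0

/-- `φ` is a holomorphic chart of `C(S)` with respect to the almost complex structure `J`:
a smooth chart with values in `ℂᵐ` such that `dφ ∘ J = i dφ`. -/
structure IsHolomorphicChart (J : (p : Cone S) → ConeTangent m p →L[ℝ] ConeTangent m p)
    (φ : OpenPartialHomeomorph (Cone S) (Fin m → ℂ)) : Prop where
  smooth : ContMDiffOn (coneI m) 𝓘(ℝ, Fin m → ℂ) ∞ φ φ.source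
  smooth_symm : ContMDiffOn 𝓘(ℝ, Fin m → ℂ) (coneI m) ∞ φ.symm φ.target
  holomorphic : ∀ q ∈ φ.source, ∀ v : ConeTangent m q, ∀ k,
    (mfderiv (coneI m) 𝓘(ℝ, Fin m → ℂ) φ q (J q v) : Fin m → ℂ) k =
      Complex.I * (mfderiv (coneI m) 𝓘(ℝ, Fin m → ℂ) φ q v : Fin m → ℂ) k

/-- `Ω` is a non-vanishing holomorphic `(m, 0)`-form: in every holomorphic chart
`u` it is `h du¹ ∧ ⋯ ∧ duᵐ` with `h` holomorphic and non-vanishing. -/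
def IsHolomorphicVolumeForm (J : (p : Cone S) → ConeTangent m p →L[ℝ] ConeTangent m p)
    (Ω : (p : Cone S) → ConeTangent m p [⋀^Fin m]→ₗ[ℝ] ℂ) : Prop :=
  ∀ φ : OpenPartialHomeomorph (Cone S) (Fin m → ℂ), IsHolomorphicChart J φ →
    ∃ h : (Fin m → ℂ) → ℂ, DifferentiableOn ℂ h φ.target ∧ (∀ u ∈ φ.target, h u ≠ 0) ∧
      ∀ q ∈ φ.source, ∀ v : Fin m → ConeTangent m q,
        Ω q v = h (φ q) * Matrix.det (Matrix.of fun i k : Fin m =>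
          (mfderiv (coneI m) 𝓘(ℝ, Fin m → ℂ) φ q (v i) : Fin m → ℂ) k)

end Basic

/-! ### Tori, fans -/

/-- The exponential map `𝔤 = ℝᵐ → Tᵐ`, `v ↦ (e^{i v¹}, …, e^{i vᵐ})`. -/
def torusExp {m : ℕ} (v : Fin m → ℝ) : Fin m → Circle := fun k => Circle.exp (v k)

/-- The inclusion `Tᵐ ⊂ T_ℂᵐ = (ℂˣ)ᵐ`. -/
def torusIncl {m : ℕ} (τ : Fin m → Circle) : Fin m → ℂˣ := fun k => Circle.toUnits (τ k)

/-- The exponential map `ℂᵐ → T_ℂᵐ`, `z ↦ (e^{z¹}, …, e^{zᵐ})`. -/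
def complexExp {m : ℕ} (z : Fin m → ℂ) : Fin m → ℂˣ :=
  fun k => Units.mk0 (Complex.exp (z k)) (Complex.exp_ne_zero _)

/-- Complex conjugation on `T_ℂᵐ`. -/
def torusConj {m : ℕ} (w : Fin m → ℂˣ) : Fin m → ℂˣ :=
  fun k => Units.map (starRingEnd ℂ).toMonoidHom (w k)

/-- An integral vector, regarded as an element of `ℝᵐ`. -/
def toReal {m : ℕ} (l : Fin m → ℤ) : Fin m → ℝ := fun k => (l k : ℝ)

/-- The convex cone in `ℝᵐ` generated by a finite set of integral vectors. -/
def generatedCone {m : ℕ} (t : Finset (Fin m → ℤ)) : Set (Fin m → ℝ) :=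
  {x | ∃ a : (Fin m → ℤ) → ℝ, (∀ l ∈ t, 0 ≤ a l) ∧ x = ∑ l ∈ t, a l • toReal l}

/-- A smooth (regular) fan in `ℝᵐ` with lattice `ℤᵐ`. Each cone of the fan is given by
the set of the primitive generators of its rays. -/
structure SmoothFan (m : ℕ) where
  cones : Set (Finset (Fin m → ℤ))
  finite : cones.Finite
  empty_mem : ∅ ∈ cones
  face : ∀ t ∈ cones, ∀ t' ⊆ t, t' ∈ cones
  smooth : ∀ t ∈ cones, ∃ b : Module.Basis (Fin m) ℤ (Fin m → ℤ), (t : Set (Fin m → ℤ)) ⊆ Set.range b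
  inter : ∀ t ∈ cones, ∀ t' ∈ cones, ∀ x, x ∈ generatedCone t → x ∈ generatedCone t' →
    ∃ t'' ⊆ t, t'' ⊆ t' ∧ x ∈ generatedCone t''

/-- The set `Λ` of the primitive generators of the one-dimensional cones of a fan. -/
def SmoothFan.rays {m : ℕ} (fan : SmoothFan m) : Set (Fin m → ℤ) := {l | {l} ∈ fan.cones}

/-- The isomorphism `(ℂˣ)ᵐ → T_ℂᵐ`, `s ↦ ∏ⱼ sⱼ^{bⱼ}`, given by a basis `b` of the lattice `ℤᵐ` of
one-parameter subgroups. -/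
def basisTorus {m : ℕ} (b : Module.Basis (Fin m) ℤ (Fin m → ℤ)) (s : Fin m → ℂˣ) : Fin m → ℂˣ :=
  fun k => ∏ j, s j ^ (b j k)

/-! ### Toric Kähler cones and toric almost Calabi–Yau cones -/

section Toric

variable (m : ℕ) (S : Type*) [TopologicalSpace S]
  [ChartedSpace (EuclideanSpace ℝ (Fin (2 * m - 1))) S] [IsManifold (𝓡 (2 * m - 1)) ∞ S]

/-- A Sasaki structure on `S`, `dim S = 2m - 1`: a Riemannian metric `g` on `S` and a complex structure
`J` on `C(S)`, compatible with the cone metric, making `C(S)` a Kähler manifold. -/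
structure KahlerCone where
  g : Bundle.ContMDiffRiemannianMetric (𝓡 (2 * m - 1)) ∞ (EuclideanSpace ℝ (Fin (2 * m - 1)))
    (fun s : S => TangentSpace (𝓡 (2 * m - 1)) s)
  J : (p : Cone S) → ConeTangent m p →L[ℝ] ConeTangent m p
  complex : ∀ p : Cone S, ∃ φ : OpenPartialHomeomorph (Cone S) (Fin m → ℂ),
    IsHolomorphicChart J φ ∧ p ∈ φ.source
  compatible : ∀ p (v w : ConeTangent m p), coneMetric g p (J p v) (J p w) = coneMetric g p v w
  closed : IsClosedTwoForm (fun p (v w : ConeTangent m p) => coneMetric g p (J p v) w)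

variable {m S}

/-- The Kähler form `ω(v, w) = ḡ(J v, w)`. -/
def KahlerCone.omega (X : KahlerCone m S) (p : Cone S) (v w : ConeTangent m p) : ℝ :=
  coneMetric X.g p (X.J p v) w

/-- The Reeb field `ξ = J (r ∂/∂r)` on `C(S)`. -/
def KahlerCone.reebField (X : KahlerCone m S) (p : Cone S) : ConeTangent m p :=
  X.J p (radial p)

/-- The one-form `η = r⁻² ḡ(ξ, ·)` on `C(S)`. -/
def KahlerCone.eta (X : KahlerCone m S) (p : Cone S) (v : ConeTangent m p) : ℝ :=
  coneMetric X.g p (X.reebField p) v / (p.2 : ℝ) ^ 2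

/-- `φ` identifies an open subset of `C(S)` with the affine toric variety of the cone `t` of the fan,
`ℂᵏ × (ℂˣ)ᵐ⁻ᵏ = {u ∈ ℂᵐ | u_j ≠ 0 unless b_j is a generator of t}`, torus-equivariantly with respect to a
basis `b` of `ℤᵐ` containing `t`, and sends the base point `p₀` to `(1, …, 1)`. -/
structure IsAffineToricChart (J : (p : Cone S) → ConeTangent m p →L[ℝ] ConeTangent m p)
    (act : (Fin m → ℂˣ) →* Equiv.Perm (Cone S)) (p₀ : Cone S) (t : Finset (Fin m → ℤ))
    (b : Module.Basis (Fin m) ℤ (Fin m → ℤ))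
    (φ : OpenPartialHomeomorph (Cone S) (Fin m → ℂ)) : Prop where
  holomorphic : IsHolomorphicChart J φ
  generators : (t : Set (Fin m → ℤ)) ⊆ Set.range b
  target_eq : φ.target = {u | ∀ j, b j ∉ t → u j ≠ 0}
  base_mem : p₀ ∈ φ.source
  base_eq : φ p₀ = 1
  act_mem : ∀ w, ∀ p ∈ φ.source, act w p ∈ φ.source
  equivariant : ∀ s : Fin m → ℂˣ, ∀ p ∈ φ.source, ∀ j,
    φ (act (basisTorus b s) p) j = (s j : ℂ) * φ p j

/-- The tangent vector at `p` of the vector field on `C(S)` generated by `v ∈ 𝔤 = ℝᵐ`, that is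
`d/dt exp(t v) · p` at `t = 0`. -/
def generated (act : (Fin m → ℂˣ) →* Equiv.Perm (Cone S)) (v : Fin m → ℝ) (p : Cone S) :
    ConeTangent m p :=
  mfderiv 𝓘(ℝ, ℝ) (coneI m) (fun t : ℝ => act (torusIncl (torusExp (t • v))) p) 0 (1 : ℝ)

variable (m S)

/-- A toric Kähler cone: the Kähler cone over a toric Sasaki manifold `S` of dimension `2m - 1` whose
Reeb field is generated by an element of `𝔤 = ℝᵐ`, with its structure of a toric variety. -/
structure ToricKahlerCone extends KahlerCone m S where
  /-- the effective action of `Tᵐ` on `S` -/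
  actS : (Fin m → Circle) →* Equiv.Perm S
  effective : Function.Injective actS
  /-- the action of `T_ℂᵐ` on `C(S)`, by biholomorphic maps -/
  act : (Fin m → ℂˣ) →* Equiv.Perm (Cone S)
  act_smooth : ∀ w, ContMDiff (coneI m) (coneI m) ∞ (act w)
  act_holomorphic : ∀ w p (v : ConeTangent m p),
    mfderiv (coneI m) (coneI m) (act w) p (J p v) = J (act w p) (mfderiv (coneI m) (coneI m) (act w) p v)
  /-- on `Tᵐ` it is the action induced by the one on `S` -/
  act_torus : ∀ τ p, act (torusIncl τ) p = (actS τ p.1, p.2)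
  act_isometric : ∀ τ p (v w : ConeTangent m p),
    coneMetric g (act (torusIncl τ) p) (mfderiv (coneI m) (coneI m) (act (torusIncl τ)) p v)
      (mfderiv (coneI m) (coneI m) (act (torusIncl τ)) p w) = coneMetric g p v w
  /-- the element of `𝔤` generating the Reeb field -/
  reeb : Fin m → ℝ
  reeb_spec : ∀ p, generated act reeb p = J p (radial p)
  /-- the fan of `C(S)` -/
  fan : SmoothFan m
  /-- the base point of the open dense orbit `U₀`, giving the identification `U₀ ≅ T_ℂᵐ` -/
  base : Cone S
  chart_exists : ∀ t ∈ fan.cones, ∃ b φ, IsAffineToricChart J act base t b φ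
  chart_cover : ∀ p, ∃ t ∈ fan.cones, ∃ b φ, IsAffineToricChart J act base t b φ ∧ p ∈ φ.source
  /-- the anti-holomorphic involution, which is complex conjugation on `U₀ ≅ T_ℂᵐ` -/
  sigma : Cone S → Cone S
  sigma_smooth : ContMDiff (coneI m) (coneI m) ∞ sigma
  sigma_sigma : ∀ p, sigma (sigma p) = p
  sigma_antiholomorphic : ∀ p (v : ConeTangent m p),
    mfderiv (coneI m) (coneI m) sigma p (J p v) = -J (sigma p) (mfderiv (coneI m) (coneI m) sigma p v)
  sigma_act : ∀ w p, sigma (act w p) = act (torusConj w) (sigma p)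
  sigma_base : sigma base = base

/-- A toric almost Calabi–Yau cone `(C(S), ω, Ω_γ)`: `γ ∈ ℤᵐ` has `⟨γ, λ⟩ = 1` for every primitive ray
generator `λ`, and `Ω_γ` is the non-vanishing holomorphic `(m, 0)`-form equal to
`exp(γ₁ z¹ + ⋯ + γₘ zᵐ) dz¹ ∧ ⋯ ∧ dzᵐ` in the logarithmic coordinates `z` of the open dense orbit. -/
structure ToricAlmostCYCone extends ToricKahlerCone m S where
  gamma : Fin m → ℤ
  gamma_ray : ∀ l ∈ fan.rays, ∑ k, gamma k * l k = 1
  Omega : (p : Cone S) → ConeTangent m p [⋀^Fin m]→ₗ[ℝ] ℂ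
  Omega_holomorphic : IsHolomorphicVolumeForm J Omega
  Omega_orbit : ∀ (z : Fin m → ℂ) (v : Fin m → (Fin m → ℂ)),
    Omega (act (complexExp z) base)
        (fun i => mfderiv 𝓘(ℝ, Fin m → ℂ) (coneI m) (fun z => act (complexExp z) base) z (v i)) =
      Complex.exp (∑ k, (gamma k : ℂ) * z k) * Matrix.det (Matrix.of fun i k : Fin m => v i k)

variable {m S}

/-- The hyperplane `H_{ζ,c}` in `𝔤*`. -/
def hyperplane (ζ : Fin m → ℝ) (c : ℝ) : Set (Fin m → ℝ) := {y | y ⬝ᵥ ζ = c}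

namespace ToricKahlerCone

variable (X : ToricKahlerCone m S)

/-- The moment map `μ : C(S) → 𝔤* = ℝᵐ`, `⟨μ(p), v⟩ = ½ r² η(v(p))`, through its components
`⟨μ(p), e_k⟩`. -/
def moment (p : Cone S) : Fin m → ℝ :=
  fun k => 1 / 2 * (p.2 : ℝ) ^ 2 * X.eta p (generated X.act (Pi.single k 1) p)

/-- The moment image `Δ`. -/
def momentImage : Set (Fin m → ℝ) := Set.range X.moment

/-- `𝔷_y`, the real span of the ray generators `λ` with `⟨y, λ⟩ = 0`. -/
def zSpan (y : Fin m → ℝ) : Submodule ℝ (Fin m → ℝ) :=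
  Submodule.span ℝ {x | ∃ l ∈ X.fan.rays, y ⬝ᵥ toReal l = 0 ∧ x = toReal l}

/-- The set `C(S)^σ_{ζ,c}` of the points `p` of the real form with `⟨μ(p), ζ⟩ = c`. -/
def realLevel (ζ : Fin m → ℝ) (c : ℝ) : Set (Cone S) :=
  {p | X.sigma p = p ∧ X.moment p ⬝ᵥ ζ = c}

/-- The map `F(p, t) = ρ(t) · τ(t) · p`, where `τ(t) = exp(f(t) ζ) · τ₀`. -/
def lagMap (ζ : Fin m → ℝ) (f : ℝ → ℝ) (ρ : ℝ → PosReal) (τ₀ : Fin m → Circle)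
    (p : Cone S) (t : ℝ) : Cone S :=
  dil (ρ t) (X.act (torusIncl (torusExp (f t • ζ) * τ₀)) p)

end ToricKahlerCone

/-! ### Submanifolds, Lagrangian angle, special Lagrangians -/

/-- `φ` is a smooth local parametrization of the subset `A` of `C(S)` by an open subset of `ℝᵏ`:
a homeomorphism from an open subset of `ℝᵏ` to a relatively open subset of `A` that is an
immersion into `C(S)`. -/
structure IsLocalParametrization {k : ℕ} (A : Set (Cone S))
    (φ : OpenPartialHomeomorph (EuclideanSpace ℝ (Fin k)) A) : Prop where
  smooth : ContMDiffOn (𝓡 k) (coneI m) ∞ (fun x => (φ x : Cone S)) φ.source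
  immersion : ∀ x ∈ φ.source,
    Function.Injective (mfderiv (𝓡 k) (coneI m) (fun x => (φ x : Cone S)) x)

/-- `A` is an embedded `k`-dimensional submanifold of `C(S)`. -/
def IsEmbeddedSubmanifold (m k : ℕ) {S : Type*} [TopologicalSpace S]
    [ChartedSpace (EuclideanSpace ℝ (Fin (2 * m - 1))) S] (A : Set (Cone S)) : Prop :=
  ∀ p : A, ∃ φ : OpenPartialHomeomorph (EuclideanSpace ℝ (Fin k)) A,
    IsLocalParametrization (m := m) A φ ∧ p ∈ φ.target

/-- The argument modulo `π` of a complex number. For a Lagrangian immersion `F` and a non-vanishing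
holomorphic `(m, 0)`-form `Ω`, the Lagrangian angle is the argument modulo `π` of the value of
`F^*Ω` on any basis of a tangent space (a change of basis changes that value by a non-zero real factor). -/
def argModPi (h : ℂ) : AddCircle Real.pi := ((Complex.arg h : ℝ) : AddCircle Real.pi)

/-- Let `A` be a subset of `C(S)` and `I` an open interval. The map `F : A × I → C(S)` is a special
Lagrangian submanifold with phase `e^{iθ₀}`: `A` is an embedded `(m-1)`-dimensional submanifold, and in the
local coordinates `(x, t)` of `A × I` given by a local parametrization of `A`, the map `F` is a smooth
immersion with `F^*ω = 0` and Lagrangian angle identically `θ₀` modulo `π`. -/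
def IsSpecialLagrangian (X : ToricAlmostCYCone m S) (A : Set (Cone S)) (I : Set ℝ)
    (F : Cone S → ℝ → Cone S) (θ₀ : ℝ) : Prop :=
  IsEmbeddedSubmanifold m (m - 1) A ∧
  ∀ φ : OpenPartialHomeomorph (EuclideanSpace ℝ (Fin (m - 1))) A,
    IsLocalParametrization (m := m) A φ →
    let G : EuclideanSpace ℝ (Fin (m - 1)) × ℝ → Cone S := fun q => F (φ q.1) q.2
    let dG := mfderiv 𝓘(ℝ, EuclideanSpace ℝ (Fin (m - 1)) × ℝ) (coneI m) G
    ContMDiffOn 𝓘(ℝ, EuclideanSpace ℝ (Fin (m - 1)) × ℝ) (coneI m) ∞ G (φ.source ×ˢ I) ∧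
    ∀ q ∈ φ.source ×ˢ I,
      Function.Injective (dG q) ∧
      (∀ v w, X.omega (G q) (dG q v) (dG q w) = 0) ∧
      ∀ e : Module.Basis (Fin m) ℝ (EuclideanSpace ℝ (Fin (m - 1)) × ℝ),
        X.Omega (G q) (fun i => dG q (e i)) ≠ 0 ∧
        argModPi (X.Omega (G q) (fun i => dG q (e i))) = ((θ₀ : ℝ) : AddCircle Real.pi)

end Toric

end ToricCone

end

noncomputable section

open scoped Topology
open Set Filter

set_option linter.unusedSectionVars false

namespace ToricCone

/-! ### Differentiating maps from normed spaces into the cone -/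

section ConeCalculus

variable {m : ℕ} {S : Type*} [TopologicalSpace S]
  [ChartedSpace (EuclideanSpace ℝ (Fin (2 * m - 1))) S]
variable {E : Type*} [NormedAddCommGroup E] [NormedSpace ℝ E]

/-! Everything is computed in affine toric charts `u`, where the torus acts by coordinatewise
multiplication, `J` is multiplication by `i` and the real form is the set of real points.

The dilation by `e^s` is the action of the complex torus element `exp(s · reeb)` (`dil_exp_eq_act`).
Hence in logarithmic coordinates on the open orbit ω is invariant under imaginary translations and
is multiplied by `e^{2s}` under translation by `s · reeb`. Inserting `reeb` and `i v` into `dω = 0`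
gives `d⟨μ, v⟩ = ω(·, X_v)`, where `X_v` is the field generated by `v`. So orbits of the compact
torus are isotropic and, by `J`-invariance, so is the real form. Density of the open orbit carries
these identities to every chart (`fderiv_chartMoment`, `pullOmega_real_real`).

At a real point `x` of the level set put `n = ζ · x` (coordinatewise, in lattice coordinates), so
that `X_ζ = i n`. The span hypothesis forces `n ≠ 0` (`mem_zSpan_of_mul_eq_zero`), and `d⟨μ, ζ⟩(n) =
ω(n, i n) > 0`. The level set is therefore a regular hypersurface of the real form, and its tangent
vectors `a` satisfy `ω(a, i n) = 0`.

As ρ is constant, the differential of `F` at `(x, s)` is the action of one fixed torus element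
applied to `(a, v) ↦ a + i f'(s) v n`. That map is injective, and ω vanishes on its image because
the three pairings real-real, `a` with `i n`, and `i n` with itself all vanish. The torus element
only rescales ω. It multiplies Ω by its γ-character, a positive real times `exp(i (f(s) N + θ))`,
while Ω on the untransformed vectors is a nonzero real times `i`. Hence the Lagrangian angle is
`f(s) N + θ + π/2` (`lagMap_pointwise`).

Since `f' ≠ 0`, this is constant modulo π only if `N = 0`, and then it equals `θ + π/2`. The
necessity direction also needs a point on the level set: replacing chart coordinates by their moduli
moves any point into the real form without changing μ (`exists_mem_realLevel`). -/

instance [IsManifold (𝓡 (2 * m - 1)) ∞ S] : IsManifold (coneI m) 1 (Cone S) :=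
  IsManifold.of_le (n := ∞) (by simp)

/-- The chart of an open subset of `ℝ` is the inclusion itself. Through this the second component of
a tangent vector of the cone is the derivative of the radius. -/
theorem hasMFDerivAt_posReal_val (r : PosReal) :
    HasMFDerivAt 𝓘(ℝ, ℝ) 𝓘(ℝ, ℝ) (Subtype.val : PosReal → ℝ) r
      (ContinuousLinearMap.id ℝ ℝ) := by
  refine ⟨continuousAt_subtype_val, ?_⟩
  have hEq : writtenInExtChartAt 𝓘(ℝ, ℝ) 𝓘(ℝ, ℝ) r (Subtype.val : PosReal → ℝ)
      =ᶠ[𝓝 (r : ℝ)] id := by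
    filter_upwards [isOpen_Ioi.mem_nhds r.2] with x hx
    have h1 : ((extChartAt 𝓘(ℝ, ℝ) r).symm x) = (⟨x, hx⟩ : PosReal) := by
      have h2 := (extChartAt 𝓘(ℝ, ℝ) r).left_inv (x := (⟨x, hx⟩ : PosReal)) (by
        simp [extChartAt, TopologicalSpace.Opens.chartAt_eq, chartAt_self_eq])
      simpa [extChartAt, TopologicalSpace.Opens.chartAt_eq, chartAt_self_eq] using h2
    change ((extChartAt 𝓘(ℝ, ℝ) r).symm x : ℝ) = x
    rw [h1]
  have : HasFDerivAt (writtenInExtChartAt 𝓘(ℝ, ℝ) 𝓘(ℝ, ℝ) r (Subtype.val : PosReal → ℝ))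
      (ContinuousLinearMap.id ℝ ℝ) (r : ℝ) := (hasFDerivAt_id _).congr_of_eventuallyEq hEq
  exact this.hasFDerivWithinAt

/-- The derivative of a map from a normed space to the cone, as a map to the model space. -/
def coneDeriv (m : ℕ) {S : Type*} [TopologicalSpace S]
    [ChartedSpace (EuclideanSpace ℝ (Fin (2 * m - 1))) S] (ψ : E → Cone S) (u : E) :
    E →L[ℝ] ConeE m :=
  mfderiv 𝓘(ℝ, E) (coneI m) ψ u

theorem mfderiv_fst_comp {ψ : E → Cone S} {u : E}
    (h : MDifferentiableAt 𝓘(ℝ, E) (coneI m) ψ u) (a : E) :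
    (mfderiv 𝓘(ℝ, E) (𝓡 (2 * m - 1)) (fun x => (ψ x).1) u a) =
      (coneDeriv m ψ u a).1 := by
  have := (hasMFDerivAt_fst (I := 𝓡 (2 * m - 1)) (I' := 𝓘(ℝ, ℝ)) (ψ u)).comp u h.hasMFDerivAt
  have h2 := this.mfderiv
  change mfderiv 𝓘(ℝ, E) (𝓡 (2 * m - 1)) (Prod.fst ∘ ψ) u a = _
  rw [h2]; rfl

theorem hasFDerivAt_radius_comp {ψ : E → Cone S} {u : E}
    (h : MDifferentiableAt 𝓘(ℝ, E) (coneI m) ψ u) :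
    HasFDerivAt (fun x => ((ψ x).2 : ℝ))
      ((ContinuousLinearMap.snd ℝ (EuclideanSpace ℝ (Fin (2 * m - 1))) ℝ).comp
        (coneDeriv m ψ u)) u := by
  have h1 := (hasMFDerivAt_snd (I := 𝓡 (2 * m - 1)) (I' := 𝓘(ℝ, ℝ)) (ψ u)).comp u h.hasMFDerivAt
  have h2 := (hasMFDerivAt_posReal_val (ψ u).2).comp u h1
  exact h2.hasFDerivAt

theorem contMDiff_radius : ContMDiff (coneI m) 𝓘(ℝ, ℝ) ∞ (fun p : Cone S => (p.2 : ℝ)) :=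
  contMDiff_subtype_val.comp contMDiff_snd

/-- This is the tangent map of `ψ` composed with a constant vector field. It presents `dψ(a)` as a
smooth section along `ψ`, the form in which the bundle metric `g` can be evaluated on it. -/
theorem contMDiffOn_mk_mfderiv [IsManifold (𝓡 (2 * m - 1)) ∞ S] {ψ : E → S} {U : Set E}
    (hU : IsOpen U) (h : ContMDiffOn 𝓘(ℝ, E) (𝓡 (2 * m - 1)) ∞ ψ U) (a : E) :
    ContMDiffOn 𝓘(ℝ, E) ((𝓡 (2 * m - 1)).prod 𝓘(ℝ, EuclideanSpace ℝ (Fin (2 * m - 1)))) ∞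
      (fun u => Bundle.TotalSpace.mk' (EuclideanSpace ℝ (Fin (2 * m - 1)))
        (E := fun s : S => TangentSpace (𝓡 (2 * m - 1)) s) (ψ u)
        (mfderiv 𝓘(ℝ, E) (𝓡 (2 * m - 1)) ψ u a)) U := by
  have : IsManifold (𝓡 (2 * m - 1)) 1 S := IsManifold.of_le (n := ∞) (by simp)
  have h1 := h.contMDiffOn_tangentMapWithin (m := ∞) (by simp) hU.uniqueMDiffOn
  have h2 : ContMDiff 𝓘(ℝ, E) (𝓘(ℝ, E).prod 𝓘(ℝ, E)) ∞
      (fun u : E => (⟨u, a⟩ : TangentBundle 𝓘(ℝ, E) E)) :=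
    contMDiff_vectorSpace_iff_contDiff.2 contDiff_const
  have h3 := h1.comp h2.contMDiffOn (s := U) (fun u hu => hu)
  refine h3.congr fun u hu => ?_
  simp [tangentMapWithin, mfderivWithin_of_isOpen hU hu]

/-- The pullback of the cone metric by a map from a normed space to the cone. -/
def pullMetric [IsManifold (𝓡 (2 * m - 1)) ∞ S]
    (g : Bundle.ContMDiffRiemannianMetric (𝓡 (2 * m - 1)) ∞ (EuclideanSpace ℝ (Fin (2 * m - 1)))
      (fun s : S => TangentSpace (𝓡 (2 * m - 1)) s))
    (ψ : E → Cone S) (u a b : E) : ℝ :=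
  coneMetric g (ψ u) (coneDeriv m ψ u a) (coneDeriv m ψ u b)

theorem contDiffOn_pullMetric [IsManifold (𝓡 (2 * m - 1)) ∞ S]
    (g : Bundle.ContMDiffRiemannianMetric (𝓡 (2 * m - 1)) ∞ (EuclideanSpace ℝ (Fin (2 * m - 1)))
      (fun s : S => TangentSpace (𝓡 (2 * m - 1)) s))
    {ψ : E → Cone S} {U : Set E} (hU : IsOpen U)
    (h : ContMDiffOn 𝓘(ℝ, E) (coneI m) ∞ ψ U) (a b : E) :
    ContDiffOn ℝ ∞ (fun u => pullMetric g ψ u a b) U := by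
  have hd : ∀ u ∈ U, MDifferentiableAt 𝓘(ℝ, E) (coneI m) ψ u := fun u hu =>
    (h.contMDiffAt (hU.mem_nhds hu)).mdifferentiableAt (by simp)
  have hfst : ContMDiffOn 𝓘(ℝ, E) (𝓡 (2 * m - 1)) ∞ (fun u => (ψ u).1) U :=
    contMDiff_fst.comp_contMDiffOn h
  have hrad : ContDiffOn ℝ ∞ (fun u => ((ψ u).2 : ℝ)) U :=
    (contMDiff_radius.comp_contMDiffOn h).contDiffOn
  have hdrad : ∀ c : E, ContDiffOn ℝ ∞
      (fun u => (coneDeriv m ψ u c).2) U := fun c => by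
    have h1 := (hrad.fderiv_of_isOpen hU (m := ∞) (by simp)).clm_apply
      (contDiffOn_const (c := c))
    refine h1.congr fun u hu => ?_
    rw [(hasFDerivAt_radius_comp (hd u hu)).fderiv]
    rfl
  have hg := g.contMDiff.comp_contMDiffOn hfst
  have hin := ContMDiffOn.clm_bundle_apply₂ (F₃ := ℝ) (E₃ := Bundle.Trivial S ℝ)
    hg (contMDiffOn_mk_mfderiv hU hfst a) (contMDiffOn_mk_mfderiv hU hfst b)
  have hin' : ContDiffOn ℝ ∞ (fun u => g.inner (ψ u).1
      (mfderiv 𝓘(ℝ, E) (𝓡 (2 * m - 1)) (fun x => (ψ x).1) u a)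
      (mfderiv 𝓘(ℝ, E) (𝓡 (2 * m - 1)) (fun x => (ψ x).1) u b)) U := by
    intro u hu
    have := (Bundle.contMDiffWithinAt_totalSpace.1 (hin u hu)).2
    simpa using this.contDiffWithinAt
  refine (((hrad.pow 2).mul hin').add ((hdrad a).mul (hdrad b))).congr fun u hu => ?_
  simp only [pullMetric, coneMetric]
  rw [← mfderiv_fst_comp (hd u hu), ← mfderiv_fst_comp (hd u hu)]

end ConeCalculus

end ToricCone

namespace ToricCone

/-! ### Closed two-forms on normed spaces -/

section FlatForms

variable {E F : Type*} [NormedAddCommGroup E] [NormedSpace ℝ E] [NormedAddCommGroup F]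
  [NormedSpace ℝ F]

/-- The pullback of a closed two-form by a map of normed spaces is closed. -/
theorem cyclic_fderiv_pullback_eq_zero {W : F → F →L[ℝ] F →L[ℝ] ℝ} {T : E → F} {z : E}
    (hW : DifferentiableAt ℝ W (T z)) (hanti : ∀ x a b, W x a b = -W x b a)
    (hclosed : ∀ a b c, fderiv ℝ W (T z) a b c + fderiv ℝ W (T z) b c a
      + fderiv ℝ W (T z) c a b = 0)
    (hT : ContDiffAt ℝ 2 T z) (a b c : E) :
    fderiv ℝ (fun x => W (T x) (fderiv ℝ T x b) (fderiv ℝ T x c)) z a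
      + fderiv ℝ (fun x => W (T x) (fderiv ℝ T x c) (fderiv ℝ T x a)) z b
      + fderiv ℝ (fun x => W (T x) (fderiv ℝ T x a) (fderiv ℝ T x b)) z c = 0 := by
  have hT1 : HasFDerivAt T (fderiv ℝ T z) z := (hT.differentiableAt (by simp)).hasFDerivAt
  have hT2 : HasFDerivAt (fderiv ℝ T) (fderiv ℝ (fderiv ℝ T) z) z :=
    ((hT.fderiv_right (m := 1) (by norm_num)).differentiableAt (by simp)).hasFDerivAt
  have hsymm : ∀ u v, fderiv ℝ (fderiv ℝ T) z u v = fderiv ℝ (fderiv ℝ T) z v u := fun u v =>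
    (hT.isSymmSndFDerivAt (by simp)) u v
  have key : ∀ u v w : E, fderiv ℝ (fun x => W (T x) (fderiv ℝ T x v) (fderiv ℝ T x w)) z u =
      fderiv ℝ W (T z) (fderiv ℝ T z u) (fderiv ℝ T z v) (fderiv ℝ T z w)
      + W (T z) (fderiv ℝ (fderiv ℝ T) z u v) (fderiv ℝ T z w)
      + W (T z) (fderiv ℝ T z v) (fderiv ℝ (fderiv ℝ T) z u w) := fun u v w => by
    have h1 : HasFDerivAt (W ∘ T) ((fderiv ℝ W (T z)).comp (fderiv ℝ T z)) z :=
      HasFDerivAt.comp (g := W) (g' := fderiv ℝ W (T z)) z hW.hasFDerivAt hT1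
    have hv := hT2.clm_apply (hasFDerivAt_const v z)
    have hw := hT2.clm_apply (hasFDerivAt_const w z)
    have h2 := (h1.clm_apply hv).clm_apply hw
    change fderiv ℝ (fun x => (W ∘ T) x (fderiv ℝ T x v) (fderiv ℝ T x w)) z u = _
    rw [h2.fderiv]
    simp
    ring
  rw [key, key, key]
  have hc := hclosed (fderiv ℝ T z a) (fderiv ℝ T z b) (fderiv ℝ T z c)
  -- Expanding the cyclic sum leaves six terms with second derivatives of `T`. By their symmetry and
  -- the antisymmetry of `W` they cancel in pairs.
  have e1 := hanti (T z) (fderiv ℝ T z b) (fderiv ℝ (fderiv ℝ T) z a c)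
  have e2 := hanti (T z) (fderiv ℝ T z c) (fderiv ℝ (fderiv ℝ T) z b a)
  have e3 := hanti (T z) (fderiv ℝ T z a) (fderiv ℝ (fderiv ℝ T) z c b)
  rw [hsymm a c] at *
  rw [hsymm b a] at *
  rw [hsymm c b] at *
  linarith

end FlatForms

/-! ### The Kähler structure read through charts -/

section KahlerCalculus

variable {m : ℕ} {S : Type*} [TopologicalSpace S]
  [ChartedSpace (EuclideanSpace ℝ (Fin (2 * m - 1))) S] [IsManifold (𝓡 (2 * m - 1)) ∞ S]
variable {E F : Type*} [NormedAddCommGroup E] [NormedSpace ℝ E] [NormedAddCommGroup F]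
  [NormedSpace ℝ F]

theorem coneDeriv_comp {ψ : F → Cone S} {κ : E → F} {x : E}
    (hψ : MDifferentiableAt 𝓘(ℝ, F) (coneI m) ψ (κ x)) (hκ : DifferentiableAt ℝ κ x) (a : E) :
    coneDeriv m (fun y => ψ (κ y)) x a = coneDeriv m ψ (κ x) (fderiv ℝ κ x a) := by
  have h := hψ.hasMFDerivAt.comp x hκ.hasFDerivAt.hasMFDerivAt
  exact congrArg (fun L : E →L[ℝ] ConeE m => L a) h.mfderiv

theorem coneDeriv_congr {ψ ψ' : E → Cone S} {x : E} (h : ψ =ᶠ[𝓝 x] ψ') :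
    coneDeriv m ψ x = coneDeriv m ψ' x := h.mfderiv_eq

theorem coneDeriv_map_comp {ψ : E → Cone S} {f : Cone S → Cone S} {x : E}
    (hf : MDifferentiableAt (coneI m) (coneI m) f (ψ x))
    (hψ : MDifferentiableAt 𝓘(ℝ, E) (coneI m) ψ x) (a : E) :
    coneDeriv m (fun y => f (ψ y)) x a =
      mfderiv (coneI m) (coneI m) f (ψ x) (coneDeriv m ψ x a) := by
  have h := hf.hasMFDerivAt.comp x hψ.hasMFDerivAt
  exact congrArg (fun L : E →L[ℝ] ConeE m => L a) h.mfderiv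

section Metric

variable (g : Bundle.ContMDiffRiemannianMetric (𝓡 (2 * m - 1)) ∞
  (EuclideanSpace ℝ (Fin (2 * m - 1))) (fun s : S => TangentSpace (𝓡 (2 * m - 1)) s))

/-- The metric of the base of the cone on the model space. -/
def baseMetric (s : S) : EuclideanSpace ℝ (Fin (2 * m - 1)) →L[ℝ]
    EuclideanSpace ℝ (Fin (2 * m - 1)) →L[ℝ] ℝ := g.inner s

/-- The cone metric as a continuous bilinear form. -/
def coneMetricB (p : Cone S) : ConeE m →L[ℝ] ConeE m →L[ℝ] ℝ :=
  ((p.2 : ℝ) ^ 2) • (baseMetric g p.1).bilinearComp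
      (ContinuousLinearMap.fst ℝ _ ℝ) (ContinuousLinearMap.fst ℝ _ ℝ)
    + (ContinuousLinearMap.mul ℝ ℝ).bilinearComp (ContinuousLinearMap.snd ℝ _ ℝ)
      (ContinuousLinearMap.snd ℝ _ ℝ)

theorem coneMetricB_eq (p : Cone S) (v w : ConeE m) :
    coneMetricB g p v w = (p.2 : ℝ) ^ 2 * baseMetric g p.1 v.1 w.1 + v.2 * w.2 := by
  simp [coneMetricB]

theorem coneMetricB_apply (p : Cone S) (v w : ConeE m) :
    coneMetricB g p v w = coneMetric g p v w := coneMetricB_eq g p v w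

theorem coneMetricB_symm (p : Cone S) (v w : ConeE m) :
    coneMetricB g p v w = coneMetricB g p w v := by
  have h : baseMetric g p.1 v.1 w.1 = baseMetric g p.1 w.1 v.1 := g.symm p.1 v.1 w.1
  rw [coneMetricB_eq, coneMetricB_eq, h, mul_comm v.2]

theorem coneMetricB_self_pos (p : Cone S) (v : ConeE m) (hv : v ≠ 0) :
    0 < coneMetricB g p v v := by
  have hr : (0 : ℝ) < (p.2 : ℝ) := p.2.2
  have hpos : ∀ w, w ≠ 0 → 0 < baseMetric g p.1 w w := g.pos p.1
  rw [coneMetricB_eq]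
  by_cases h : v.1 = 0
  · have h2 : v.2 ≠ 0 := fun h2 => hv (Prod.ext h h2)
    have := mul_self_pos.2 h2
    rw [h]
    simpa using h2
  · have := mul_pos (pow_pos hr 2) (hpos v.1 h)
    have := mul_self_nonneg v.2
    linarith

end Metric

/-- The derivative of a map from the cone to `ℂᵐ`, as a map from the model space. -/
def chartDeriv (φ : Cone S → Fin m → ℂ) (p : Cone S) : ConeE m →L[ℝ] (Fin m → ℂ) :=
  mfderiv (coneI m) 𝓘(ℝ, Fin m → ℂ) φ p

theorem IsHolomorphicChart.contMDiffAt {J : (p : Cone S) → ConeTangent m p →L[ℝ] ConeTangent m p}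
    {φ : OpenPartialHomeomorph (Cone S) (Fin m → ℂ)} (h : IsHolomorphicChart J φ) {p : Cone S}
    (hp : p ∈ φ.source) : ContMDiffAt (coneI m) 𝓘(ℝ, Fin m → ℂ) ∞ φ p :=
  h.smooth.contMDiffAt (φ.open_source.mem_nhds hp)

theorem IsHolomorphicChart.contMDiffAt_symm
    {J : (p : Cone S) → ConeTangent m p →L[ℝ] ConeTangent m p}
    {φ : OpenPartialHomeomorph (Cone S) (Fin m → ℂ)} (h : IsHolomorphicChart J φ) {u : Fin m → ℂ}
    (hu : u ∈ φ.target) : ContMDiffAt 𝓘(ℝ, Fin m → ℂ) (coneI m) ∞ φ.symm u :=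
  h.smooth_symm.contMDiffAt (φ.open_target.mem_nhds hu)

theorem IsHolomorphicChart.chartDeriv_coneDeriv
    {J : (p : Cone S) → ConeTangent m p →L[ℝ] ConeTangent m p}
    {φ : OpenPartialHomeomorph (Cone S) (Fin m → ℂ)} (h : IsHolomorphicChart J φ) {u : Fin m → ℂ}
    (hu : u ∈ φ.target) (a : Fin m → ℂ) :
    chartDeriv φ (φ.symm u) (coneDeriv m φ.symm u a) = a := by
  have h1 := ((h.contMDiffAt (φ.map_target hu)).mdifferentiableAt (by simp)).hasMFDerivAt.comp u
    ((h.contMDiffAt_symm hu).mdifferentiableAt (by simp)).hasMFDerivAt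
  have h2 : (φ ∘ φ.symm) =ᶠ[𝓝 u] id := by
    filter_upwards [φ.open_target.mem_nhds hu] with y hy using φ.right_inv hy
  have h3 := h1.mfderiv
  rw [h2.mfderiv_eq, mfderiv_id] at h3
  exact congrArg (fun L : (Fin m → ℂ) →L[ℝ] (Fin m → ℂ) => L a) h3.symm

theorem IsHolomorphicChart.coneDeriv_chartDeriv
    {J : (p : Cone S) → ConeTangent m p →L[ℝ] ConeTangent m p}
    {φ : OpenPartialHomeomorph (Cone S) (Fin m → ℂ)} (h : IsHolomorphicChart J φ) {p : Cone S}
    (hp : p ∈ φ.source) (v : ConeE m) :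
    coneDeriv m φ.symm (φ p) (chartDeriv φ p v) = v := by
  have hg := ((h.contMDiffAt_symm (φ.map_source hp)).mdifferentiableAt (by simp)).hasMFDerivAt
  have h1 := hg.comp p ((h.contMDiffAt hp).mdifferentiableAt (by simp)).hasMFDerivAt
  have h2 : (φ.symm ∘ φ) =ᶠ[𝓝 p] id := by
    filter_upwards [φ.open_source.mem_nhds hp] with y hy using φ.left_inv hy
  have h3 := h1.mfderiv
  rw [h2.mfderiv_eq, mfderiv_id] at h3
  exact congrArg (fun L : ConeE m →L[ℝ] ConeE m => L v) h3.symm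

/-- A field of endomorphisms of the tangent spaces of the cone, on the model space. -/
def flatJ (J : (p : Cone S) → ConeTangent m p →L[ℝ] ConeTangent m p) (p : Cone S) :
    ConeE m →L[ℝ] ConeE m := J p

theorem IsHolomorphicChart.chartDeriv_flatJ
    {J : (p : Cone S) → ConeTangent m p →L[ℝ] ConeTangent m p}
    {φ : OpenPartialHomeomorph (Cone S) (Fin m → ℂ)} (h : IsHolomorphicChart J φ) {p : Cone S}
    (hp : p ∈ φ.source) (v : ConeE m) :
    chartDeriv φ p (flatJ J p v) = Complex.I • chartDeriv φ p v :=
  funext fun k => h.holomorphic p hp v k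

theorem IsHolomorphicChart.flatJ_coneDeriv
    {J : (p : Cone S) → ConeTangent m p →L[ℝ] ConeTangent m p}
    {φ : OpenPartialHomeomorph (Cone S) (Fin m → ℂ)} (h : IsHolomorphicChart J φ) {u : Fin m → ℂ}
    (hu : u ∈ φ.target) (a : Fin m → ℂ) :
    flatJ J (φ.symm u) (coneDeriv m φ.symm u a) = coneDeriv m φ.symm u (Complex.I • a) := by
  have h1 := h.coneDeriv_chartDeriv (φ.map_target hu)
    (flatJ J (φ.symm u) (coneDeriv m φ.symm u a))
  rw [h.chartDeriv_flatJ (φ.map_target hu), h.chartDeriv_coneDeriv hu, φ.right_inv hu] at h1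
  exact h1.symm

namespace KahlerCone

variable (X : KahlerCone m S)

/-- `J² = -1` is not a field of `KahlerCone`; it follows from the existence of holomorphic charts,
where `J` is multiplication by `i`. -/
theorem flatJ_flatJ (p : Cone S) (v : ConeE m) : flatJ X.J p (flatJ X.J p v) = -v := by
  obtain ⟨φ, h, hp⟩ := X.complex p
  rw [← h.coneDeriv_chartDeriv hp (flatJ X.J p (flatJ X.J p v)), h.chartDeriv_flatJ hp,
    h.chartDeriv_flatJ hp, smul_smul, Complex.I_mul_I, neg_one_smul, map_neg,
    h.coneDeriv_chartDeriv hp]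

theorem coneMetricB_flatJ_flatJ (p : Cone S) (v w : ConeE m) :
    coneMetricB X.g p (flatJ X.J p v) (flatJ X.J p w) = coneMetricB X.g p v w :=
  X.compatible p v w

/-- The Kähler form as a continuous bilinear form. -/
def omegaB (p : Cone S) : ConeE m →L[ℝ] ConeE m →L[ℝ] ℝ :=
  (coneMetricB X.g p).comp (flatJ X.J p)

theorem omegaB_eq (p : Cone S) (v w : ConeE m) :
    X.omegaB p v w = coneMetricB X.g p (flatJ X.J p v) w := rfl

theorem omegaB_apply (p : Cone S) (v w : ConeE m) : X.omegaB p v w = X.omega p v w :=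
  coneMetricB_apply X.g p (flatJ X.J p v) w

theorem omegaB_anti (p : Cone S) (v w : ConeE m) : X.omegaB p v w = -X.omegaB p w v := by
  rw [omegaB_eq, omegaB_eq, ← X.coneMetricB_flatJ_flatJ p _ w, flatJ_flatJ, map_neg,
    neg_apply, coneMetricB_symm]

theorem omegaB_flatJ_flatJ (p : Cone S) (v w : ConeE m) :
    X.omegaB p (flatJ X.J p v) (flatJ X.J p w) = X.omegaB p v w :=
  X.coneMetricB_flatJ_flatJ p _ _

/-- The pullback of the Kähler form by a map from a normed space to the cone. -/
def pullOmega (ψ : E → Cone S) (u : E) : E →L[ℝ] E →L[ℝ] ℝ :=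
  (X.omegaB (ψ u)).bilinearComp (coneDeriv m ψ u) (coneDeriv m ψ u)

theorem pullOmega_apply (ψ : E → Cone S) (u a b : E) :
    X.pullOmega ψ u a b = X.omegaB (ψ u) (coneDeriv m ψ u a) (coneDeriv m ψ u b) := rfl

theorem pullOmega_anti (ψ : E → Cone S) (u a b : E) :
    X.pullOmega ψ u a b = -X.pullOmega ψ u b a := by
  rw [pullOmega_apply, pullOmega_apply, X.omegaB_anti]

theorem pullOmega_comp {ψ : F → Cone S} {κ : E → F} {x : E}
    (hψ : MDifferentiableAt 𝓘(ℝ, F) (coneI m) ψ (κ x)) (hκ : DifferentiableAt ℝ κ x) (a b : E) :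
    X.pullOmega (fun y => ψ (κ y)) x a b =
      X.pullOmega ψ (κ x) (fderiv ℝ κ x a) (fderiv ℝ κ x b) := by
  rw [pullOmega_apply, pullOmega_apply, coneDeriv_comp hψ hκ, coneDeriv_comp hψ hκ]

theorem pullOmega_congr {ψ ψ' : E → Cone S} {x : E} (h : ψ =ᶠ[𝓝 x] ψ') :
    X.pullOmega ψ x = X.pullOmega ψ' x := by
  unfold pullOmega
  rw [coneDeriv_congr h, h.self_of_nhds]

/-- No smoothness of `J` is assumed. In a holomorphic chart `J` is the constant `i`, so the
coefficients of ω are metric coefficients of `i a` and `b`. -/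
theorem contDiffOn_pullOmega_chart {φ : OpenPartialHomeomorph (Cone S) (Fin m → ℂ)}
    (h : IsHolomorphicChart X.J φ) : ContDiffOn ℝ ∞ (X.pullOmega φ.symm) φ.target := by
  refine contDiffOn_clm_apply.2 fun a => contDiffOn_clm_apply.2 fun b => ?_
  refine (contDiffOn_pullMetric X.g φ.open_target h.smooth_symm (Complex.I • a) b).congr
    fun u hu => ?_
  rw [pullOmega_apply, omegaB_eq, h.flatJ_coneDeriv hu, coneMetricB_apply]
  rfl

theorem contDiffAt_pullOmega {ψ : E → Cone S} {U : Set E} (hU : IsOpen U)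
    (hψ : ContMDiffOn 𝓘(ℝ, E) (coneI m) ∞ ψ U) {z : E} (hz : z ∈ U) (a b : E) :
    ContDiffAt ℝ ∞ (fun x => X.pullOmega ψ x a b) z := by
  obtain ⟨φ, h, hp⟩ := X.complex (ψ z)
  have hc : ContinuousAt ψ z := (hψ.contMDiffAt (hU.mem_nhds hz)).continuousAt
  have hκ : ContDiffAt ℝ ∞ (fun x => φ (ψ x)) z :=
    ((h.contMDiffAt hp).comp z (hψ.contMDiffAt (hU.mem_nhds hz))).contDiffAt
  have hκ' := hκ.fderiv_right (m := ∞) (by simp)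
  have hW : ContDiffAt ℝ ∞ (X.pullOmega φ.symm) (φ (ψ z)) :=
    (X.contDiffOn_pullOmega_chart h).contDiffAt (φ.open_target.mem_nhds (φ.map_source hp))
  have hcomp := ((hW.comp z hκ).clm_apply (hκ'.clm_apply contDiffAt_const (g := fun _ => a))).clm_apply
    (hκ'.clm_apply (contDiffAt_const (c := b)))
  refine hcomp.congr_of_eventuallyEq ?_
  have h1 : ∀ᶠ x in 𝓝 z, ψ x ∈ φ.source := hc.eventually (φ.open_source.mem_nhds hp)
  filter_upwards [h1.eventually_nhds, (hκ.of_le (m := 1) (by simp)).eventually (by simp)]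
    with x hx hκx
  have hx' : ψ x ∈ φ.source := hx.self_of_nhds
  have he : ψ =ᶠ[𝓝 x] fun y => φ.symm (φ (ψ y)) := by
    filter_upwards [hx] with y hy using (φ.left_inv hy).symm
  rw [X.pullOmega_congr he]
  exact X.pullOmega_comp (ψ := φ.symm) (κ := fun x => φ (ψ x)) (x := x)
    ((h.contMDiffAt_symm (φ.map_source hx')).mdifferentiableAt (by simp))
    (hκx.differentiableAt (by simp)) a b

/-- The pullback of the Kähler form to a normed space is closed. -/
theorem cyclic_fderiv_pullOmega_eq_zero {ψ : E → Cone S} {U : Set E} (hU : IsOpen U)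
    (hψ : ContMDiffOn 𝓘(ℝ, E) (coneI m) ∞ ψ U) {z : E} (hz : z ∈ U) (a b c : E) :
    fderiv ℝ (fun x => X.pullOmega ψ x b c) z a + fderiv ℝ (fun x => X.pullOmega ψ x c a) z b
      + fderiv ℝ (fun x => X.pullOmega ψ x a b) z c = 0 := by
  have hψz := hψ.contMDiffAt (hU.mem_nhds hz)
  -- The field `closed` speaks only of the manifold's own charts, so `ψ` is factored locally as
  -- `χ.symm` after `χ ∘ ψ` and the flat statement is applied to `χ ∘ ψ`.
  set χ := extChartAt (coneI m) (ψ z) with hχ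
  have hto : IsOpen χ.target := isOpen_extChartAt_target (ψ z)
  have hχs : ContMDiffOn 𝓘(ℝ, ConeE m) (coneI m) ∞ χ.symm χ.target :=
    contMDiffOn_extChartAt_symm (ψ z)
  have hT : ContDiffAt ℝ ∞ (fun x => χ (ψ x)) z :=
    (contMDiffAt_extChartAt.comp z hψz).contDiffAt
  have hmem : χ (ψ z) ∈ χ.target := mem_extChartAt_target (ψ z)
  have hd : ∀ y ∈ χ.target, ∀ a b, DifferentiableAt ℝ (fun x => X.pullOmega χ.symm x a b) y :=
    fun y hy a b => (X.contDiffAt_pullOmega hto hχs hy a b).differentiableAt (by simp)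
  have hW : DifferentiableAt ℝ (X.pullOmega χ.symm) (χ (ψ z)) := by
    have : ContDiffOn ℝ ∞ (X.pullOmega χ.symm) χ.target :=
      contDiffOn_clm_apply.2 fun a => contDiffOn_clm_apply.2 fun b => fun y hy =>
        (X.contDiffAt_pullOmega hto hχs hy a b).contDiffWithinAt
    exact (this.contDiffAt (hto.mem_nhds hmem)).differentiableAt (by simp)
  have hfd : ∀ a b c, fderiv ℝ (fun x => X.pullOmega χ.symm x b c) (χ (ψ z)) a =
      fderiv ℝ (X.pullOmega χ.symm) (χ (ψ z)) a b c := fun a b c => by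
    have := (hW.hasFDerivAt.clm_apply (hasFDerivAt_const b _)).clm_apply (hasFDerivAt_const c _)
    rw [this.fderiv]
    simp
  have hclosed : ∀ a b c, fderiv ℝ (X.pullOmega χ.symm) (χ (ψ z)) a b c
      + fderiv ℝ (X.pullOmega χ.symm) (χ (ψ z)) b c a
      + fderiv ℝ (X.pullOmega χ.symm) (χ (ψ z)) c a b = 0 := fun a b c => by
    have h := X.closed (ψ z) (χ (ψ z)) hmem a b c
    rw [← hfd, ← hfd, ← hfd]
    simp only [pullOmega_apply, omegaB_apply]
    exact h
  have key := cyclic_fderiv_pullback_eq_zero (T := fun x => χ (ψ x)) hW (X.pullOmega_anti χ.symm) hclosed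
    (hT.of_le (WithTop.coe_le_coe.2 le_top)) a b c
  have hsrc : ∀ᶠ x in 𝓝 z, ψ x ∈ χ.source :=
    hψz.continuousAt.eventually (extChartAt_source_mem_nhds (ψ z))
  have heq : ∀ b c, (fun x => X.pullOmega ψ x b c) =ᶠ[𝓝 z] fun x =>
      X.pullOmega χ.symm (χ (ψ x)) (fderiv ℝ (fun x => χ (ψ x)) x b)
        (fderiv ℝ (fun x => χ (ψ x)) x c) := fun b c => by
    filter_upwards [hsrc.eventually_nhds, (hT.of_le (m := 1) (by simp)).eventually (by simp)]
      with x hx hTx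
    have hx' : ψ x ∈ χ.source := hx.self_of_nhds
    have he : ψ =ᶠ[𝓝 x] fun y => χ.symm (χ (ψ y)) := by
      filter_upwards [hx] with y hy using (χ.left_inv hy).symm
    rw [X.pullOmega_congr he]
    exact X.pullOmega_comp (ψ := χ.symm) (κ := fun x => χ (ψ x)) (x := x)
      ((hχs.contMDiffAt (hto.mem_nhds (χ.map_source hx'))).mdifferentiableAt (by simp))
      (hTx.differentiableAt (by simp)) b c
  rw [(heq b c).fderiv_eq, (heq c a).fderiv_eq, (heq a b).fderiv_eq]
  exact key

end KahlerCone

end KahlerCalculus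

end ToricCone

namespace ToricCone

/-! ### Lattice coordinates and exponentials -/

section Torus

variable {m : ℕ}

/-- The coordinates with respect to a lattice basis, over an arbitrary commutative ring. -/
def latCoord (b : Module.Basis (Fin m) ℤ (Fin m → ℤ)) (R : Type*) [CommRing R] :
    (Fin m → R) ≃ₗ[R] (Fin m → R) where
  toFun z j := ∑ k, z k * (b.repr (Pi.single k 1) j : R)
  invFun y k := ∑ j, y j * (b j k : R)
  map_add' x y := by
    funext j
    simp [add_mul, Finset.sum_add_distrib]
  map_smul' c x := by
    funext j
    simp [Finset.mul_sum, mul_assoc]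
  left_inv z := by
    funext l
    simp only [Finset.sum_mul]
    rw [Finset.sum_comm]
    have h : ∀ k, ∑ j, (b.repr (Pi.single k 1) j : R) * (b j l : R) =
        ((Pi.single k (1 : ℤ) : Fin m → ℤ) l : R) := fun k => by
      have h1 := congrFun (b.sum_repr (Pi.single k 1)) l
      rw [← h1]
      simp
    simp only [mul_assoc, ← Finset.mul_sum, h]
    simp [Pi.single_apply]
  right_inv y := by
    funext j
    simp only [Finset.sum_mul]
    rw [Finset.sum_comm]
    have h : ∀ l, ∑ k, (b l k : R) * (b.repr (Pi.single k 1) j : R) =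
        ((Finsupp.single l (1 : ℤ) : Fin m →₀ ℤ) j : R) := fun l => by
      have h1 : b l = ∑ k, b l k • (Pi.single k 1 : Fin m → ℤ) := by
        funext i
        simp [Pi.single_apply]
      have h2 := congrArg (fun v => b.repr v j) h1
      simp only [Module.Basis.repr_self, map_sum, map_smul, Finsupp.coe_finsetSum,
        Finset.sum_apply, Finsupp.smul_apply, smul_eq_mul] at h2
      rw [h2]
      push_cast
      rfl
    simp only [mul_assoc, ← Finset.mul_sum, h]
    simp [Finsupp.single_apply]

theorem latCoord_symm_apply (b : Module.Basis (Fin m) ℤ (Fin m → ℤ)) (R : Type*) [CommRing R]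
    (y : Fin m → R) (k : Fin m) : (latCoord b R).symm y k = ∑ j, y j * (b j k : R) := rfl

theorem latCoord_apply (b : Module.Basis (Fin m) ℤ (Fin m → ℤ)) (R : Type*) [CommRing R]
    (z : Fin m → R) (j : Fin m) :
    latCoord b R z j = ∑ k, z k * (b.repr (Pi.single k 1) j : R) := rfl

/-- The inclusion `ℝᵐ ⊂ ℂᵐ`. -/
def cplx : (Fin m → ℝ) →L[ℝ] (Fin m → ℂ) :=
  ContinuousLinearMap.pi fun k => Complex.ofRealCLM.comp (ContinuousLinearMap.proj k)

@[simp] theorem cplx_apply (x : Fin m → ℝ) (k : Fin m) : cplx x k = (x k : ℂ) := rfl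

/-- Complex conjugation on `ℂᵐ`. -/
def conjVec : (Fin m → ℂ) →L[ℝ] (Fin m → ℂ) :=
  ContinuousLinearMap.pi fun k =>
    (Complex.conjCLE : ℂ →L[ℝ] ℂ).comp (ContinuousLinearMap.proj k)

@[simp] theorem conjVec_apply (z : Fin m → ℂ) (k : Fin m) :
    conjVec z k = (starRingEnd ℂ) (z k) := rfl

theorem conjVec_eq_self_iff {z : Fin m → ℂ} : conjVec z = z ↔ ∃ x, z = cplx x := by
  constructor
  · intro h
    refine ⟨fun k => (z k).re, funext fun k => ?_⟩
    exact (Complex.conj_eq_iff_re.1 (congrFun h k)).symm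
  · rintro ⟨x, rfl⟩
    funext k
    simp

theorem latCoord_cplx (b : Module.Basis (Fin m) ℤ (Fin m → ℤ)) (x : Fin m → ℝ) :
    latCoord b ℂ (cplx x) = cplx (latCoord b ℝ x) := by
  funext j
  simp [latCoord_apply]

theorem latCoord_conjVec (b : Module.Basis (Fin m) ℤ (Fin m → ℤ)) (z : Fin m → ℂ) :
    latCoord b ℂ (conjVec z) = conjVec (latCoord b ℂ z) := by
  funext j
  simp [latCoord_apply, map_sum]

theorem latCoord_symm_conjVec (b : Module.Basis (Fin m) ℤ (Fin m → ℤ)) (z : Fin m → ℂ) :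
    (latCoord b ℂ).symm (conjVec z) = conjVec ((latCoord b ℂ).symm z) := by
  funext j
  simp [latCoord_symm_apply, map_sum]

theorem latCoord_toReal (b : Module.Basis (Fin m) ℤ (Fin m → ℤ)) (j : Fin m) :
    latCoord b ℝ (toReal (b j)) = Pi.single j 1 := by
  rw [← LinearEquiv.eq_symm_apply]
  funext k
  simp [latCoord_symm_apply, toReal, Pi.single_apply]

/-- The coordinatewise exponential. -/
def expVec (y : Fin m → ℂ) : Fin m → ℂ := fun j => Complex.exp (y j)

@[simp] theorem expVec_apply (y : Fin m → ℂ) (j : Fin m) : expVec y j = Complex.exp (y j) := rfl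

theorem expVec_add (y z : Fin m → ℂ) : expVec (y + z) = expVec y * expVec z :=
  funext fun _ => Complex.exp_add _ _

theorem conjVec_expVec (y : Fin m → ℂ) : conjVec (expVec y) = expVec (conjVec y) :=
  funext fun _ => (Complex.exp_conj _).symm

theorem exists_expVec_eq {u : Fin m → ℂ} (hu : ∀ j, u j ≠ 0) : ∃ y, expVec y = u :=
  ⟨fun j => Complex.log (u j), funext fun j => Complex.exp_log (hu j)⟩

theorem hasFDerivAt_expVec (y : Fin m → ℂ) :
    HasFDerivAt expVec (ContinuousLinearMap.pi fun j =>
      (Complex.exp (y j)) • (ContinuousLinearMap.proj j : (Fin m → ℂ) →L[ℝ] ℂ)) y := by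
  refine hasFDerivAt_pi.2 fun j => ?_
  have h := (Complex.hasDerivAt_exp (y j)).hasFDerivAt.restrictScalars ℝ
  have h2 := h.comp y (ContinuousLinearMap.proj (R := ℝ) (φ := fun _ : Fin m => ℂ) j).hasFDerivAt
  refine h2.congr_fderiv ?_
  ext v
  simp [mul_comm]

theorem contDiff_expVec : ContDiff ℝ ∞ (expVec : (Fin m → ℂ) → Fin m → ℂ) :=
  contDiff_pi.2 fun j => Complex.contDiff_exp.comp (contDiff_apply ℝ ℂ j)

theorem complexExp_add (z w : Fin m → ℂ) : complexExp (z + w) = complexExp z * complexExp w := by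
  funext k
  ext
  simp [complexExp, Complex.exp_add]

theorem complexExp_latCoord_symm (b : Module.Basis (Fin m) ℤ (Fin m → ℤ)) (y : Fin m → ℂ) :
    complexExp ((latCoord b ℂ).symm y) = basisTorus b (complexExp y) := by
  funext k
  ext
  simp only [complexExp, basisTorus, latCoord_symm_apply, Units.val_mk0, Complex.exp_sum,
    Units.coe_prod, Units.val_zpow_eq_zpow_val]
  refine Finset.prod_congr rfl fun j _ => ?_
  rw [mul_comm, Complex.exp_int_mul]

theorem torusIncl_torusExp (v : Fin m → ℝ) :
    torusIncl (torusExp v) = complexExp (Complex.I • cplx v) := by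
  funext k
  ext
  simp [torusIncl, torusExp, complexExp, mul_comm]

theorem torusIncl_mul (s t : Fin m → Circle) :
    torusIncl (s * t) = torusIncl s * torusIncl t := by
  funext k
  simp [torusIncl]

theorem torusConj_complexExp (z : Fin m → ℂ) :
    torusConj (complexExp z) = complexExp (conjVec z) := by
  funext k
  ext
  simp [torusConj, complexExp, Complex.exp_conj]

/-- Two continuous functions on an open set that agree where no coordinate vanishes are equal. -/
theorem eqOn_of_eq_of_forall_ne_zero {𝕜 Y : Type*} [NontriviallyNormedField 𝕜]
    [TopologicalSpace Y] [T2Space Y] {V : Set (Fin m → 𝕜)} (hV : IsOpen V)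
    {f g : (Fin m → 𝕜) → Y} (hf : ContinuousOn f V) (hg : ContinuousOn g V)
    (h : ∀ u ∈ V, (∀ j, u j ≠ 0) → f u = g u) : EqOn f g V := by
  have hd : Dense {u : Fin m → 𝕜 | ∀ j, u j ≠ 0} := by
    have h1 := dense_pi (univ : Set (Fin m)) (s := fun _ => ({0}ᶜ : Set 𝕜))
      (fun _ _ => dense_compl_singleton 0)
    refine h1.mono fun u hu j => ?_
    simpa using hu j (mem_univ j)
  refine EqOn.of_subset_closure (s := V ∩ {u | ∀ j, u j ≠ 0}) (fun u hu => h u hu.1 hu.2) hf hg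
    inter_subset_left ?_
  exact hd.open_subset_closure_inter hV

end Torus

end ToricCone

namespace ToricCone

/-! ### Affine toric charts and dilations -/

section Charts

variable {m : ℕ} {S : Type*} [TopologicalSpace S]
  [ChartedSpace (EuclideanSpace ℝ (Fin (2 * m - 1))) S] [IsManifold (𝓡 (2 * m - 1)) ∞ S]
variable {E : Type*} [NormedAddCommGroup E] [NormedSpace ℝ E]

theorem act_complexExp_add (act : (Fin m → ℂˣ) →* Equiv.Perm (Cone S)) (z w : Fin m → ℂ)
    (p : Cone S) : act (complexExp (z + w)) p = act (complexExp z) (act (complexExp w) p) := by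
  rw [complexExp_add, map_mul, Equiv.Perm.mul_apply]

namespace IsAffineToricChart

variable {J : (p : Cone S) → ConeTangent m p →L[ℝ] ConeTangent m p}
  {act : (Fin m → ℂˣ) →* Equiv.Perm (Cone S)} {p₀ : Cone S} {t : Finset (Fin m → ℤ)}
  {b : Module.Basis (Fin m) ℤ (Fin m → ℤ)} {φ : OpenPartialHomeomorph (Cone S) (Fin m → ℂ)}

theorem mul_mem_target (h : IsAffineToricChart J act p₀ t b φ) {u : Fin m → ℂ} (hu : u ∈ φ.target) (y : Fin m → ℂ) :
    expVec y * u ∈ φ.target := by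
  rw [h.target_eq] at hu ⊢
  exact fun j hj => mul_ne_zero (Complex.exp_ne_zero _) (hu j hj)

theorem conjVec_mem_target (h : IsAffineToricChart J act p₀ t b φ) {u : Fin m → ℂ} (hu : u ∈ φ.target) : conjVec u ∈ φ.target := by
  rw [h.target_eq] at hu ⊢
  exact fun j hj => (map_ne_zero (starRingEnd ℂ)).2 (hu j hj)

theorem expVec_mem_target (h : IsAffineToricChart J act p₀ t b φ) (y : Fin m → ℂ) : expVec y ∈ φ.target := by
  rw [h.target_eq]
  exact fun j _ => Complex.exp_ne_zero _

/-- Equivariance in exponential form: in the chart the action is multiplication by the exponential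
of the lattice coordinates. -/
theorem act_symm (h : IsAffineToricChart J act p₀ t b φ) (z : Fin m → ℂ) {u : Fin m → ℂ} (hu : u ∈ φ.target) :
    act (complexExp z) (φ.symm u) = φ.symm (expVec (latCoord b ℂ z) * u) := by
  have h1 := h.equivariant (complexExp (latCoord b ℂ z)) (φ.symm u) (φ.map_target hu)
  rw [← complexExp_latCoord_symm, LinearEquiv.symm_apply_apply, φ.right_inv hu] at h1
  have h2 : φ (act (complexExp z) (φ.symm u)) = expVec (latCoord b ℂ z) * u := funext h1
  rw [← h2, φ.left_inv (h.act_mem _ _ (φ.map_target hu))]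

theorem act_base (h : IsAffineToricChart J act p₀ t b φ) (z : Fin m → ℂ) :
    act (complexExp z) p₀ = φ.symm (expVec (latCoord b ℂ z)) := by
  have h1 : p₀ = φ.symm 1 := by rw [← h.base_eq, φ.left_inv h.base_mem]
  rw [h1, h.act_symm z (by rw [← h.base_eq]; exact φ.map_source h.base_mem), mul_one]

theorem mdifferentiableAt_symm (h : IsAffineToricChart J act p₀ t b φ) {u : Fin m → ℂ} (hu : u ∈ φ.target) :
    MDifferentiableAt 𝓘(ℝ, Fin m → ℂ) (coneI m) φ.symm u :=
  (h.holomorphic.contMDiffAt_symm hu).mdifferentiableAt (by simp)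

theorem injective_coneDeriv (h : IsAffineToricChart J act p₀ t b φ) {u : Fin m → ℂ} (hu : u ∈ φ.target) :
    Function.Injective (coneDeriv m φ.symm u) :=
  Function.LeftInverse.injective (h.holomorphic.chartDeriv_coneDeriv hu)

/-- In the chart the orbit curve is `s ↦ exp(i s v) u`, with `v` in lattice coordinates, and its
velocity at `0` is `i v u`. -/
theorem generated_symm (h : IsAffineToricChart J act p₀ t b φ) (v : Fin m → ℝ) {u : Fin m → ℂ} (hu : u ∈ φ.target) :
    generated act v (φ.symm u) =
      coneDeriv m φ.symm u (Complex.I • (cplx (latCoord b ℝ v) * u)) := by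
  set κ : ℝ → Fin m → ℂ := fun s => expVec (s • (Complex.I • cplx (latCoord b ℝ v))) * u with hκ
  have h1 : (fun s : ℝ => act (torusIncl (torusExp (s • v))) (φ.symm u)) =
      fun s => φ.symm (κ s) := by
    funext s
    rw [torusIncl_torusExp, h.act_symm _ hu, map_smul, latCoord_cplx, map_smul, map_smul,
      smul_comm]
  have h0 : κ 0 = u := by
    funext j
    simp [hκ]
  have hd : HasDerivAt κ (Complex.I • (cplx (latCoord b ℝ v) * u)) 0 := by
    refine hasDerivAt_pi.2 fun j => ?_
    have e1 : HasDerivAt (fun s : ℝ => (s : ℂ) * (Complex.I * (latCoord b ℝ v j : ℂ)))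
        (Complex.I * (latCoord b ℝ v j : ℂ)) 0 := by
      simpa using (Complex.ofRealCLM.hasDerivAt (x := (0 : ℝ))).mul_const
        (Complex.I * (latCoord b ℝ v j : ℂ))
    have e2 := e1.cexp.mul_const (u j)
    refine (e2.congr_deriv ?_).congr_of_eventuallyEq (Eventually.of_forall fun s => ?_)
    · simp [mul_assoc]
    · simp [hκ]
  have h2 := coneDeriv_comp (m := m) (ψ := φ.symm) (κ := κ) (x := (0 : ℝ))
    (by rw [h0]; exact h.mdifferentiableAt_symm hu) hd.differentiableAt 1
  rw [h0, fderiv_apply_one_eq_deriv, hd.deriv] at h2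
  rw [← h2]
  unfold generated
  rw [h1]
  rfl

end IsAffineToricChart

theorem continuous_dil_exp (p : Cone S) :
    Continuous fun t : ℝ => dil ⟨Real.exp t, Real.exp_pos t⟩ p := by
  unfold dil
  refine continuous_const.prodMk (Continuous.subtype_mk ?_ _)
  fun_prop

theorem contMDiff_dil_exp (p : Cone S) :
    ContMDiff 𝓘(ℝ, ℝ) (coneI m) ∞ fun t : ℝ => dil ⟨Real.exp t, Real.exp_pos t⟩ p := by
  unfold dil
  refine contMDiff_const.prodMk ?_
  rw [← ContMDiff.subtypeVal_comp_iff]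
  have : ContDiff ℝ ∞ fun t : ℝ => Real.exp t * (p.2 : ℝ) := by fun_prop
  exact this.contMDiff

/-- The position vector, as an element of the model space. -/
def flatRadial (m : ℕ) {S : Type*} [TopologicalSpace S]
    [ChartedSpace (EuclideanSpace ℝ (Fin (2 * m - 1))) S] (p : Cone S) : ConeE m :=
  radial (m := m) p

theorem coneDeriv_dil_exp (p : Cone S) (t : ℝ) :
    coneDeriv m (fun t : ℝ => dil ⟨Real.exp t, Real.exp_pos t⟩ p) t 1 =
      flatRadial m (dil ⟨Real.exp t, Real.exp_pos t⟩ p) := by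
  have hd := (contMDiff_dil_exp (m := m) p).mdifferentiableAt (x := t) (by simp)
  refine Prod.ext ?_ ?_
  · rw [← mfderiv_fst_comp hd]
    change mfderiv 𝓘(ℝ, ℝ) (𝓡 (2 * m - 1)) (fun _ : ℝ => p.1) t 1 = 0
    rw [mfderiv_const]
    rfl
  · have h1 := hasFDerivAt_radius_comp hd
    have h2 : HasDerivAt (fun t : ℝ => Real.exp t * (p.2 : ℝ)) (Real.exp t * (p.2 : ℝ)) t :=
      (Real.hasDerivAt_exp t).mul_const _
    exact h1.hasDerivAt.unique h2

end Charts

end ToricCone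

namespace ToricCone

/-! ### The involution and the dilations as toric objects -/

namespace ToricKahlerCone

variable {m : ℕ} {S : Type*} [TopologicalSpace S]
  [ChartedSpace (EuclideanSpace ℝ (Fin (2 * m - 1))) S] [IsManifold (𝓡 (2 * m - 1)) ∞ S]
variable {E : Type*} [NormedAddCommGroup E] [NormedSpace ℝ E]
variable (X : ToricKahlerCone m S) {t : Finset (Fin m → ℤ)}
  {b : Module.Basis (Fin m) ℤ (Fin m → ℤ)} {φ : OpenPartialHomeomorph (Cone S) (Fin m → ℂ)}

/-- The logarithmic parametrization of the open orbit. -/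
def logMap (z : Fin m → ℂ) : Cone S := X.act (complexExp z) X.base

theorem logMap_eq (h : IsAffineToricChart X.J X.act X.base t b φ) (z : Fin m → ℂ) :
    X.logMap z = φ.symm (expVec (latCoord b ℂ z)) := h.act_base z

theorem logMap_add (z w : Fin m → ℂ) :
    X.logMap (z + w) = X.act (complexExp z) (X.logMap w) := act_complexExp_add _ _ _ _

theorem contDiff_latCoord (b : Module.Basis (Fin m) ℤ (Fin m → ℤ)) :
    ContDiff ℝ ∞ (latCoord b ℂ) :=
  ((latCoord b ℂ).toLinearMap.restrictScalars ℝ).toContinuousLinearMap.contDiff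

theorem contMDiff_logMap : ContMDiff 𝓘(ℝ, Fin m → ℂ) (coneI m) ∞ X.logMap := by
  obtain ⟨b, φ, h⟩ := X.chart_exists ∅ X.fan.empty_mem
  have h1 : ContMDiff 𝓘(ℝ, Fin m → ℂ) 𝓘(ℝ, Fin m → ℂ) ∞
      (fun z : Fin m → ℂ => expVec (latCoord b ℂ z)) :=
    (contDiff_expVec.comp (contDiff_latCoord b)).contMDiff
  have h2 := h.holomorphic.smooth_symm.comp_contMDiff h1 fun z => h.expVec_mem_target _
  exact h2.congr fun z => X.logMap_eq h z

theorem mdifferentiable_act (w : Fin m → ℂˣ) :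
    MDifferentiable (coneI m) (coneI m) (X.act w) :=
  (X.act_smooth w).mdifferentiable (by simp)

/-- On the open orbit this is forced by `sigma_act` and `sigma_base`; the coordinate hyperplanes are
reached by density. -/
theorem sigma_symm [T2Space S] (h : IsAffineToricChart X.J X.act X.base t b φ) {u : Fin m → ℂ}
    (hu : u ∈ φ.target) : X.sigma (φ.symm u) = φ.symm (conjVec u) := by
  refine eqOn_of_eq_of_forall_ne_zero φ.open_target
    (f := fun u => X.sigma (φ.symm u)) (g := fun u => φ.symm (conjVec u))
    (X.sigma_smooth.continuous.comp_continuousOn φ.continuousOn_symm)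
    (φ.continuousOn_symm.comp conjVec.continuous.continuousOn
      fun u hu => h.conjVec_mem_target hu) (fun u _ hu0 => ?_) hu
  obtain ⟨y, rfl⟩ := exists_expVec_eq hu0
  have e : ∀ y, φ.symm (expVec y) = X.act (complexExp ((latCoord b ℂ).symm y)) X.base :=
    fun y => by rw [h.act_base, LinearEquiv.apply_symm_apply]
  change X.sigma (φ.symm (expVec y)) = φ.symm (conjVec (expVec y))
  rw [conjVec_expVec, e, e, X.sigma_act, X.sigma_base, torusConj_complexExp,
    latCoord_symm_conjVec]

/-- The Reeb field `J (r ∂/∂r)` is `i β u` with `β` the coordinates of `reeb`; applying `J` once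
more recovers `r ∂/∂r = β u`. -/
theorem radial_symm (h : IsAffineToricChart X.J X.act X.base t b φ) {u : Fin m → ℂ}
    (hu : u ∈ φ.target) :
    flatRadial m (φ.symm u) =
      coneDeriv m φ.symm u (cplx (latCoord b ℝ X.reeb) * u) := by
  have h1 : flatJ X.J (φ.symm u) (flatRadial m (φ.symm u)) =
      coneDeriv m φ.symm u (Complex.I • (cplx (latCoord b ℝ X.reeb) * u)) :=
    (X.reeb_spec (φ.symm u)).symm.trans (h.generated_symm X.reeb hu)
  rw [← h.holomorphic.flatJ_coneDeriv hu] at h1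
  have h2 := congrArg (flatJ X.J (φ.symm u)) h1
  rw [X.flatJ_flatJ, X.flatJ_flatJ] at h2
  exact neg_injective h2

theorem act_real_smul_add (v : Fin m → ℂ) (s t : ℝ) (p : Cone S) :
    X.act (complexExp (((s + t : ℝ)) • v)) p =
      X.act (complexExp (s • v)) (X.act (complexExp (t • v)) p) := by
  rw [add_smul, act_complexExp_add]

theorem chartDeriv_radial (h : IsAffineToricChart X.J X.act X.base t b φ) {p : Cone S}
    (hp : p ∈ φ.source) :
    chartDeriv φ p (flatRadial m p) = cplx (latCoord b ℝ X.reeb) * φ p := by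
  have h1 := X.radial_symm h (φ.map_source hp)
  have h2 := h.holomorphic.chartDeriv_coneDeriv (φ.map_source hp)
    (cplx (latCoord b ℝ X.reeb) * φ p)
  rw [← h1, φ.left_inv hp] at h2
  exact h2

theorem continuous_act_curve (v : Fin m → ℂ) (p : Cone S) :
    Continuous fun s : ℝ => X.act (complexExp (s • v)) p := by
  obtain ⟨t, -, b, φ, h, hp⟩ := X.chart_cover p
  have h1 : (fun s : ℝ => X.act (complexExp (s • v)) p) =
      fun s : ℝ => φ.symm (expVec (latCoord b ℂ (s • v)) * φ p) := by
    funext s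
    conv_lhs => rw [← φ.left_inv hp]
    exact h.act_symm _ (φ.map_source hp)
  rw [h1]
  refine φ.continuousOn_symm.comp_continuous ?_ fun s => h.mul_mem_target (φ.map_source hp) _
  have h2 := contDiff_expVec.continuous.comp (contDiff_latCoord b).continuous
  exact (h2.comp (continuous_id.smul continuous_const)).mul continuous_const

/-- Both curves start at `p` and solve the linear equation `u' = β u` in a chart. Only small `s` are
treated, since the dilated point must stay in the chart. -/
theorem eventually_dil_exp (p : Cone S) :
    ∀ᶠ s : ℝ in 𝓝 0, dil ⟨Real.exp s, Real.exp_pos s⟩ p =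
      X.act (complexExp (s • cplx X.reeb)) p := by
  obtain ⟨t, -, b, φ, h, hp⟩ := X.chart_cover p
  set d : ℝ → Cone S := fun s => dil ⟨Real.exp s, Real.exp_pos s⟩ p with hd
  have hd0 : d 0 = p := by
    refine Prod.ext rfl (Subtype.ext ?_)
    simp [hd, dil]
  have hev : ∀ᶠ s in 𝓝 (0 : ℝ), d s ∈ φ.source :=
    (continuous_dil_exp p).continuousAt.eventually
      (φ.open_source.mem_nhds (by change d 0 ∈ _; rw [hd0]; exact hp))
  obtain ⟨ε, hε, hball⟩ := Metric.eventually_nhds_iff_ball.1 hev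
  set β := latCoord b ℝ X.reeb with hβ
  have hx : ∀ s ∈ Metric.ball (0 : ℝ) ε,
      HasDerivAt (fun s => φ (d s)) (cplx β * φ (d s)) s := fun s hs => by
    have h1 := ((h.holomorphic.contMDiffAt (hball s hs)).mdifferentiableAt
      (by simp)).hasMFDerivAt.comp s
      ((contMDiff_dil_exp (m := m) p).mdifferentiableAt (x := s) (by simp)).hasMFDerivAt
    have h2 : HasFDerivAt (fun s => φ (d s)) ((chartDeriv φ (d s)).comp (coneDeriv m d s)) s :=
      h1.hasFDerivAt
    have h3 := X.chartDeriv_radial h (hball s hs)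
    refine h2.hasDerivAt.congr_deriv ?_
    rw [← h3, ← coneDeriv_dil_exp]
    rfl
  -- The integrating factor `exp(-s β_j)` turns the linear equation into a vanishing derivative on a
  -- connected interval.
  have hconst : ∀ s ∈ Metric.ball (0 : ℝ) ε, ∀ j,
      Complex.exp (-(s * β j : ℂ)) * φ (d s) j = φ p j := fun s hs j => by
    have hder : ∀ s ∈ Metric.ball (0 : ℝ) ε,
        HasDerivAt (fun s : ℝ => Complex.exp (-(s * β j : ℂ)) * φ (d s) j) 0 s := fun s hs => by
      have e1 : HasDerivAt (fun s : ℝ => -((s : ℂ) * β j)) (-(β j : ℂ)) s := by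
        simpa using ((Complex.ofRealCLM.hasDerivAt (x := s)).mul_const (β j : ℂ)).fun_neg
      refine (e1.cexp.mul (hasDerivAt_pi.1 (hx s hs) j)).congr_deriv ?_
      simp
      ring
    have := (Metric.isOpen_ball).is_const_of_deriv_eq_zero (convex_ball 0 ε).isPreconnected
      (fun s hs => (hder s hs).differentiableAt.differentiableWithinAt)
      (fun s hs => (hder s hs).deriv) hs (Metric.mem_ball_self hε)
    rw [this, hd0]
    simp
  filter_upwards [Metric.ball_mem_nhds 0 hε] with s hs
  have h4 : φ (d s) = expVec (latCoord b ℂ (s • cplx X.reeb)) * φ p := by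
    funext j
    have h5 := hconst s hs j
    rw [← map_smul, latCoord_cplx, map_smul, ← hβ]
    rw [Pi.mul_apply, ← h5, ← mul_assoc]
    simp [← Complex.exp_add]
  change d s = _
  rw [← φ.left_inv (hball s hs), h4, ← h.act_symm _ (φ.map_source hp), φ.left_inv hp]

/-- The dilations of the cone are given by the complex torus. -/
theorem dil_exp_eq_act [T2Space S] (p : Cone S) (s : ℝ) :
    dil ⟨Real.exp s, Real.exp_pos s⟩ p = X.act (complexExp (s • cplx X.reeb)) p := by
  set A : Set ℝ := {s | dil ⟨Real.exp s, Real.exp_pos s⟩ p =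
    X.act (complexExp (s • cplx X.reeb)) p} with hA
  have hdil : ∀ s s' : ℝ, dil ⟨Real.exp (s + s'), Real.exp_pos _⟩ p =
      dil ⟨Real.exp s, Real.exp_pos s⟩ (dil ⟨Real.exp s', Real.exp_pos s'⟩ p) := fun s s' => by
    refine Prod.ext rfl (Subtype.ext ?_)
    simp [dil, Real.exp_add, mul_assoc]
  have hclosed : IsClosed A := isClosed_eq (continuous_dil_exp p) (X.continuous_act_curve _ p)
  -- Both sides are one-parameter groups, so agreement near `0` propagates. The set of good times is
  -- open, closed and contains `0`, hence is all of `ℝ`.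
  have hopen : IsOpen A := by
    refine isOpen_iff_mem_nhds.2 fun s hs => ?_
    have h1 := X.eventually_dil_exp (dil ⟨Real.exp s, Real.exp_pos s⟩ p)
    have h2 : Tendsto (fun s' : ℝ => s' - s) (𝓝 s) (𝓝 0) := by
      have : Continuous fun s' : ℝ => s' - s := by fun_prop
      simpa using this.tendsto s
    filter_upwards [h2.eventually h1] with s' hs'
    change _ = _
    have h3 := hdil (s' - s) s
    have h4 := X.act_real_smul_add (cplx X.reeb) (s' - s) s p
    have hs2 : dil ⟨Real.exp s, Real.exp_pos s⟩ p = X.act (complexExp (s • cplx X.reeb)) p := hs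
    rw [hs', hs2, ← h4] at h3
    simpa using h3
  have h0 : (0 : ℝ) ∈ A := (X.eventually_dil_exp p).self_of_nhds
  have h5 : s ∈ A := by
    rw [IsClopen.eq_univ ⟨hclosed, hopen⟩ ⟨0, h0⟩]
    exact mem_univ s
  exact h5

end ToricKahlerCone

end ToricCone

namespace ToricCone

/-! ### Behaviour of the Kähler form under the torus -/

namespace ToricKahlerCone

variable {m : ℕ} {S : Type*} [TopologicalSpace S]
  [ChartedSpace (EuclideanSpace ℝ (Fin (2 * m - 1))) S] [IsManifold (𝓡 (2 * m - 1)) ∞ S]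
variable {E : Type*} [NormedAddCommGroup E] [NormedSpace ℝ E]
variable (X : ToricKahlerCone m S) {t : Finset (Fin m → ℤ)}
  {b : Module.Basis (Fin m) ℤ (Fin m → ℤ)} {φ : OpenPartialHomeomorph (Cone S) (Fin m → ℂ)}

/-- The differential of the action of an element of the complex torus. -/
def actDeriv (w : Fin m → ℂˣ) (p : Cone S) : ConeE m →L[ℝ] ConeE m :=
  mfderiv (coneI m) (coneI m) (X.act w) p

theorem flatJ_actDeriv (w : Fin m → ℂˣ) (p : Cone S) (v : ConeE m) :
    flatJ X.J (X.act w p) (X.actDeriv w p v) = X.actDeriv w p (flatJ X.J p v) :=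
  (X.act_holomorphic w p v).symm

theorem coneDeriv_act {ψ : E → Cone S} {u : E} (w : Fin m → ℂˣ)
    (hψ : MDifferentiableAt 𝓘(ℝ, E) (coneI m) ψ u) (a : E) :
    coneDeriv m (fun x => X.act w (ψ x)) u a = X.actDeriv w (ψ u) (coneDeriv m ψ u a) :=
  coneDeriv_map_comp (X.mdifferentiable_act w _) hψ a

/-- The action commutes with `J`, so ω scales by the same factor as the metric. -/
theorem pullOmega_act_of_conformal {w : Fin m → ℂˣ} {k : ℝ}
    (hw : ∀ p v v', coneMetricB X.g (X.act w p) (X.actDeriv w p v) (X.actDeriv w p v') =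
      k * coneMetricB X.g p v v') {ψ : E → Cone S} {u : E}
    (hψ : MDifferentiableAt 𝓘(ℝ, E) (coneI m) ψ u) :
    X.pullOmega (fun x => X.act w (ψ x)) u = k • X.pullOmega ψ u := by
  ext a c
  rw [KahlerCone.pullOmega_apply, X.coneDeriv_act w hψ, X.coneDeriv_act w hψ,
    KahlerCone.omegaB_eq, X.flatJ_actDeriv, hw]
  rfl

theorem coneMetricB_act_torus (y : Fin m → ℝ) (p : Cone S) (v v' : ConeE m) :
    coneMetricB X.g (X.act (complexExp (Complex.I • cplx y)) p)
      (X.actDeriv (complexExp (Complex.I • cplx y)) p v)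
      (X.actDeriv (complexExp (Complex.I • cplx y)) p v') = coneMetricB X.g p v v' := by
  rw [← torusIncl_torusExp]
  exact X.act_isometric (torusExp y) p v v'

/-- The element acts as the dilation by `e^s`, which fixes the `S` component and scales the radius.
A chart is inserted because the two components are computed for maps defined on normed spaces. -/
theorem actDeriv_reeb [T2Space S] (s : ℝ) (p : Cone S) (v : ConeE m) :
    X.actDeriv (complexExp (s • cplx X.reeb)) p v = (v.1, Real.exp s * v.2) := by
  obtain ⟨t, -, b, φ, h, hp⟩ := X.chart_cover p
  set w := complexExp (s • cplx X.reeb) with hw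
  have hd := h.mdifferentiableAt_symm (φ.map_source hp)
  have h1 := X.coneDeriv_act w hd (chartDeriv φ p v)
  rw [φ.left_inv hp, h.holomorphic.coneDeriv_chartDeriv hp] at h1
  rw [← h1]
  have h2 : MDifferentiableAt 𝓘(ℝ, Fin m → ℂ) (coneI m) (fun x => X.act w (φ.symm x)) (φ p) :=
    (X.mdifferentiable_act w _).comp _ hd
  have hdil : ∀ q, X.act w q = dil ⟨Real.exp s, Real.exp_pos s⟩ q := fun q =>
    (X.dil_exp_eq_act q s).symm
  have h3 := h.holomorphic.coneDeriv_chartDeriv hp v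
  refine Prod.ext ?_ ?_
  · rw [← mfderiv_fst_comp h2]
    have : (fun x => (X.act w (φ.symm x)).1) = fun x => (φ.symm x).1 := by
      funext x
      rw [hdil]
      rfl
    rw [this]
    refine (mfderiv_fst_comp hd _).trans ?_
    rw [h3]
  · have e1 := hasFDerivAt_radius_comp h2
    have e2 := (hasFDerivAt_radius_comp hd).const_mul (Real.exp s)
    have : (fun x => ((X.act w (φ.symm x)).2 : ℝ)) =
        fun x => Real.exp s * ((φ.symm x).2 : ℝ) := by
      funext x
      rw [hdil]
      rfl
    rw [this] at e1
    have e3 := congrArg (fun L : (Fin m → ℂ) →L[ℝ] ℝ => L (chartDeriv φ p v)) (e1.unique e2)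
    refine e3.trans ?_
    change Real.exp s * (coneDeriv m φ.symm (φ p) (chartDeriv φ p v)).2 = _
    rw [h3]

theorem coneMetricB_act_reeb [T2Space S] (s : ℝ) (p : Cone S) (v v' : ConeE m) :
    coneMetricB X.g (X.act (complexExp (s • cplx X.reeb)) p)
      (X.actDeriv (complexExp (s • cplx X.reeb)) p v)
      (X.actDeriv (complexExp (s • cplx X.reeb)) p v') =
      Real.exp (2 * s) * coneMetricB X.g p v v' := by
  rw [X.actDeriv_reeb, X.actDeriv_reeb, ← X.dil_exp_eq_act, coneMetricB_eq, coneMetricB_eq,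
    two_mul s, Real.exp_add]
  simp only [dil]
  ring

theorem pullOmega_act [T2Space S] (s : ℝ) (y : Fin m → ℝ) {ψ : E → Cone S} {u : E}
    (hψ : MDifferentiableAt 𝓘(ℝ, E) (coneI m) ψ u) :
    X.pullOmega (fun x => X.act (complexExp (s • cplx X.reeb + Complex.I • cplx y)) (ψ x)) u =
      Real.exp (2 * s) • X.pullOmega ψ u := by
  have h1 := X.pullOmega_act_of_conformal (k := 1)
    (fun p v v' => (X.coneMetricB_act_torus y p v v').trans (one_mul _).symm) hψ
  have h2 : MDifferentiableAt 𝓘(ℝ, E) (coneI m)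
      (fun x => X.act (complexExp (Complex.I • cplx y)) (ψ x)) u :=
    (X.mdifferentiable_act _ _).comp _ hψ
  have h3 := X.pullOmega_act_of_conformal (X.coneMetricB_act_reeb s) h2
  rw [h1, one_smul] at h3
  simp only [act_complexExp_add]
  exact h3

/-! ### The Kähler form and the moment map in logarithmic coordinates -/

theorem mdifferentiable_logMap : MDifferentiable 𝓘(ℝ, Fin m → ℂ) (coneI m) X.logMap :=
  X.contMDiff_logMap.mdifferentiable (by simp)

/-- Translation in logarithmic coordinates is the torus action: ω has translation-invariant
coefficients in imaginary directions and is homogeneous of degree two along `reeb`. -/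
theorem pullOmega_logMap_add [T2Space S] (s : ℝ) (y : Fin m → ℝ) (z : Fin m → ℂ) :
    X.pullOmega X.logMap (z + (s • cplx X.reeb + Complex.I • cplx y)) =
      Real.exp (2 * s) • X.pullOmega X.logMap z := by
  set w := s • cplx X.reeb + Complex.I • cplx y with hw
  have h1 := X.pullOmega_act s y (X.mdifferentiable_logMap z)
  have h2 : (fun x => X.act (complexExp w) (X.logMap x)) = fun x => X.logMap (x + w) := by
    funext x
    rw [add_comm, X.logMap_add]
  rw [← h1, ← hw, h2]
  ext a c
  rw [X.pullOmega_comp (ψ := X.logMap) (κ := fun x => x + w)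
    (X.mdifferentiable_logMap _) (by fun_prop)]
  simp [fderiv_add_const]

theorem differentiable_pullOmega_logMap (a c : Fin m → ℂ) :
    Differentiable ℝ fun z => X.pullOmega X.logMap z a c := fun _ =>
  (X.contDiffAt_pullOmega isOpen_univ X.contMDiff_logMap.contMDiffOn (mem_univ _) a
    c).differentiableAt (by simp)

theorem fderiv_pullOmega_logMap_imag [T2Space S] (z a c : Fin m → ℂ) (y : Fin m → ℝ) :
    fderiv ℝ (fun z => X.pullOmega X.logMap z a c) z (Complex.I • cplx y) = 0 := by
  have h1 := ((X.differentiable_pullOmega_logMap a c z).hasFDerivAt.hasLineDerivAt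
    (Complex.I • cplx y))
  have h2 : (fun s : ℝ => X.pullOmega X.logMap (z + s • (Complex.I • cplx y)) a c) =
      fun _ => X.pullOmega X.logMap z a c := by
    funext s
    have := X.pullOmega_logMap_add 0 (s • y) z
    rw [zero_smul, zero_add, mul_zero, Real.exp_zero, one_smul, map_smul, smul_comm] at this
    rw [this]
  unfold HasLineDerivAt at h1
  rw [h2] at h1
  exact h1.unique (hasDerivAt_const _ _)

theorem fderiv_pullOmega_logMap_reeb [T2Space S] (z a c : Fin m → ℂ) :
    fderiv ℝ (fun z => X.pullOmega X.logMap z a c) z (cplx X.reeb) =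
      2 * X.pullOmega X.logMap z a c := by
  have h1 := ((X.differentiable_pullOmega_logMap a c z).hasFDerivAt.hasLineDerivAt
    (cplx X.reeb))
  have h2 : (fun s : ℝ => X.pullOmega X.logMap (z + s • cplx X.reeb) a c) =
      fun s => Real.exp (2 * s) * X.pullOmega X.logMap z a c := by
    funext s
    have := X.pullOmega_logMap_add s 0 z
    rw [map_zero, smul_zero, add_zero] at this
    rw [this]
    rfl
  unfold HasLineDerivAt at h1
  rw [h2] at h1
  have h3 : HasDerivAt (fun s : ℝ => Real.exp (2 * s) * X.pullOmega X.logMap z a c)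
      (2 * X.pullOmega X.logMap z a c) 0 := by
    have e : HasDerivAt (fun s : ℝ => 2 * s) 2 0 := by
      simpa using (hasDerivAt_id (0 : ℝ)).const_mul 2
    simpa using e.exp.mul_const (X.pullOmega X.logMap z a c)
  exact h1.unique h3

/-- The component of the moment map along `v`, in logarithmic coordinates, is a potential for
the contraction of the Kähler form with the field generated by `v`. -/
theorem fderiv_pullOmega_logMap_reeb_imag [T2Space S] (z a : Fin m → ℂ) (v : Fin m → ℝ) :
    fderiv ℝ (fun z => X.pullOmega X.logMap z (cplx X.reeb) (Complex.I • cplx v)) z a =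
      2 * X.pullOmega X.logMap z a (Complex.I • cplx v) := by
  have h := X.cyclic_fderiv_pullOmega_eq_zero isOpen_univ X.contMDiff_logMap.contMDiffOn
    (mem_univ z) a (cplx X.reeb) (Complex.I • cplx v)
  rw [X.fderiv_pullOmega_logMap_imag, X.fderiv_pullOmega_logMap_reeb,
    X.pullOmega_anti _ _ (Complex.I • cplx v) a] at h
  linarith

/-- The potential for contraction with the `y`-field is invariant under the compact torus, so its
derivative along an orbit vanishes. -/
theorem pullOmega_logMap_imag_imag [T2Space S] (z : Fin m → ℂ) (x y : Fin m → ℝ) :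
    X.pullOmega X.logMap z (Complex.I • cplx x) (Complex.I • cplx y) = 0 := by
  have h1 := X.fderiv_pullOmega_logMap_reeb_imag z (Complex.I • cplx x) y
  rw [X.fderiv_pullOmega_logMap_imag] at h1
  linarith

end ToricKahlerCone

end ToricCone

/-! ### Moment map and real form in affine charts -/

namespace ToricCone

variable {m : ℕ}

/-- The exponential of lattice coordinates, `ℂᵐ → (ℂˣ)ᵐ`. -/
def orbitExp (b : Module.Basis (Fin m) ℤ (Fin m → ℤ)) (z : Fin m → ℂ) : Fin m → ℂ :=
  expVec (latCoord b ℂ z)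

theorem orbitExp_ne_zero (b : Module.Basis (Fin m) ℤ (Fin m → ℤ)) (z : Fin m → ℂ) (j : Fin m) :
    orbitExp b z j ≠ 0 := Complex.exp_ne_zero _

theorem orbitExp_add (b : Module.Basis (Fin m) ℤ (Fin m → ℤ)) (z w : Fin m → ℂ) :
    orbitExp b (z + w) = orbitExp b z * orbitExp b w := by
  simp only [orbitExp, map_add, expVec_add]

theorem conjVec_orbitExp (b : Module.Basis (Fin m) ℤ (Fin m → ℤ)) (z : Fin m → ℂ) :
    conjVec (orbitExp b z) = orbitExp b (conjVec z) := by
  simp only [orbitExp, latCoord_conjVec, conjVec_expVec]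

theorem exists_orbitExp_eq (b : Module.Basis (Fin m) ℤ (Fin m → ℤ)) {u : Fin m → ℂ}
    (hu : ∀ j, u j ≠ 0) : ∃ z, orbitExp b z = u := by
  obtain ⟨y, hy⟩ := exists_expVec_eq hu
  exact ⟨(latCoord b ℂ).symm y, by rw [orbitExp, LinearEquiv.apply_symm_apply, hy]⟩

theorem hasFDerivAt_orbitExp (b : Module.Basis (Fin m) ℤ (Fin m → ℤ)) (z : Fin m → ℂ) :
    ∃ L : (Fin m → ℂ) →L[ℝ] (Fin m → ℂ), HasFDerivAt (orbitExp b) L z ∧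
      ∀ a, L a = orbitExp b z * latCoord b ℂ a := by
  set B : (Fin m → ℂ) →L[ℝ] (Fin m → ℂ) :=
    ((latCoord b ℂ).toLinearMap.restrictScalars ℝ).toContinuousLinearMap with hB
  refine ⟨_, (hasFDerivAt_expVec (latCoord b ℂ z)).comp z B.hasFDerivAt, fun a => ?_⟩
  funext j
  simp [hB, orbitExp]

theorem differentiableAt_orbitExp (b : Module.Basis (Fin m) ℤ (Fin m → ℤ)) (z : Fin m → ℂ) :
    DifferentiableAt ℝ (orbitExp b) z := by
  obtain ⟨L, h, -⟩ := hasFDerivAt_orbitExp b z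
  exact h.differentiableAt

theorem fderiv_orbitExp (b : Module.Basis (Fin m) ℤ (Fin m → ℤ)) (z a : Fin m → ℂ) :
    fderiv ℝ (orbitExp b) z a = orbitExp b z * latCoord b ℂ a := by
  obtain ⟨L, h, h'⟩ := hasFDerivAt_orbitExp b z
  rw [h.fderiv, h']

namespace ToricKahlerCone

variable {S : Type*} [TopologicalSpace S]
  [ChartedSpace (EuclideanSpace ℝ (Fin (2 * m - 1))) S] [IsManifold (𝓡 (2 * m - 1)) ∞ S]
variable (X : ToricKahlerCone m S) {t : Finset (Fin m → ℤ)}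
  {b : Module.Basis (Fin m) ℤ (Fin m → ℤ)} {φ : OpenPartialHomeomorph (Cone S) (Fin m → ℂ)}

theorem coneDeriv_logMap (h : IsAffineToricChart X.J X.act X.base t b φ) (z a : Fin m → ℂ) :
    coneDeriv m X.logMap z a =
      coneDeriv m φ.symm (orbitExp b z) (orbitExp b z * latCoord b ℂ a) := by
  have h1 : X.logMap = fun z => φ.symm (orbitExp b z) := funext fun z => X.logMap_eq h z
  rw [h1, coneDeriv_comp (κ := orbitExp b) (h.mdifferentiableAt_symm (h.expVec_mem_target _))
    (differentiableAt_orbitExp b z), fderiv_orbitExp]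

theorem pullOmega_logMap (h : IsAffineToricChart X.J X.act X.base t b φ) (z a c : Fin m → ℂ) :
    X.pullOmega X.logMap z a c = X.pullOmega φ.symm (orbitExp b z)
      (orbitExp b z * latCoord b ℂ a) (orbitExp b z * latCoord b ℂ c) := by
  rw [KahlerCone.pullOmega_apply, X.coneDeriv_logMap h, X.coneDeriv_logMap h, X.logMap_eq h]
  rfl

theorem pullOmega_symm_I_I (h : IsAffineToricChart X.J X.act X.base t b φ) {u : Fin m → ℂ}
    (hu : u ∈ φ.target) (a c : Fin m → ℂ) :
    X.pullOmega φ.symm u (Complex.I • a) (Complex.I • c) = X.pullOmega φ.symm u a c := by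
  rw [KahlerCone.pullOmega_apply, ← h.holomorphic.flatJ_coneDeriv hu,
    ← h.holomorphic.flatJ_coneDeriv hu, X.omegaB_flatJ_flatJ]
  rfl

theorem pullOmega_symm_I_pos (h : IsAffineToricChart X.J X.act X.base t b φ) {u : Fin m → ℂ}
    (hu : u ∈ φ.target) {a : Fin m → ℂ} (ha : a ≠ 0) :
    0 < X.pullOmega φ.symm u a (Complex.I • a) := by
  rw [KahlerCone.pullOmega_apply, KahlerCone.omegaB_eq, h.holomorphic.flatJ_coneDeriv hu]
  refine coneMetricB_self_pos _ _ _ fun h0 => ha ?_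
  have h1 := h.injective_coneDeriv hu (h0.trans (map_zero _).symm)
  exact (smul_eq_zero.1 h1).resolve_left Complex.I_ne_zero

/-- The function `⟨μ, v⟩` in an affine toric chart, up to the factor `1/2`. -/
def chartMoment (b : Module.Basis (Fin m) ℤ (Fin m → ℤ))
    (φ : OpenPartialHomeomorph (Cone S) (Fin m → ℂ)) (v : Fin m → ℝ) (u : Fin m → ℂ) : ℝ :=
  X.pullOmega φ.symm u (cplx (latCoord b ℝ X.reeb) * u)
    (Complex.I • (cplx (latCoord b ℝ v) * u))

/-- The factor `r²` cancels the `r⁻²` in η, and `ḡ(J (r ∂/∂r), ·)` is ω contracted with `r ∂/∂r`. -/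
theorem moment_eq (p : Cone S) (k : Fin m) :
    X.moment p k = 1 / 2 * X.omegaB p (flatRadial m p)
      (generated X.act (Pi.single k 1) p : ConeE m) := by
  have hr : (p.2 : ℝ) ≠ 0 := (Set.mem_Ioi.1 p.2.2).ne'
  simp only [moment, KahlerCone.eta, KahlerCone.reebField]
  rw [mul_assoc, mul_div_cancel₀ _ (pow_ne_zero 2 hr)]
  congr 1

theorem moment_dotProduct (h : IsAffineToricChart X.J X.act X.base t b φ) {u : Fin m → ℂ}
    (hu : u ∈ φ.target) (v : Fin m → ℝ) :
    X.moment (φ.symm u) ⬝ᵥ v = 1 / 2 * X.chartMoment b φ v u := by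
  have h1 : ∀ k, X.moment (φ.symm u) k = 1 / 2 * X.chartMoment b φ (Pi.single k 1) u := by
    intro k
    rw [moment_eq, X.radial_symm h hu, h.generated_symm _ hu]
    rfl
  set T : (Fin m → ℝ) →ₗ[ℝ] (Fin m → ℂ) :=
    { toFun := fun v => Complex.I • (cplx (latCoord b ℝ v) * u)
      map_add' := fun x y => by rw [map_add, map_add, add_mul, smul_add]
      map_smul' := fun s x => by
        rw [map_smul, map_smul, RingHom.id_apply, smul_mul_assoc, smul_comm] } with hT
  have h2 : ∀ v, X.chartMoment b φ v u =
      X.pullOmega φ.symm u (cplx (latCoord b ℝ X.reeb) * u) (T v) := fun v => rfl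
  have h3 : v = ∑ k, v k • (Pi.single k 1 : Fin m → ℝ) := by
    funext i
    simp [Pi.single_apply]
  conv_rhs => rw [h2, h3, map_sum, map_sum, Finset.mul_sum]
  rw [dotProduct]
  refine Finset.sum_congr rfl fun k _ => ?_
  rw [h1, h2, map_smul, map_smul, smul_eq_mul]
  ring

theorem contDiffOn_chartMoment (h : IsAffineToricChart X.J X.act X.base t b φ) (v : Fin m → ℝ) :
    ContDiffOn ℝ ∞ (X.chartMoment b φ v) φ.target :=
  ((X.contDiffOn_pullOmega_chart h.holomorphic).clm_apply (by fun_prop)).clm_apply (by fun_prop)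

/-- This is `d⟨μ, v⟩ = ω(·, X_v)` up to the factor two. It is known on the open orbit from
logarithmic coordinates; both sides are continuous on the chart, so it persists where coordinates
vanish. -/
theorem fderiv_chartMoment [T2Space S] (h : IsAffineToricChart X.J X.act X.base t b φ)
    {u : Fin m → ℂ} (hu : u ∈ φ.target) (v : Fin m → ℝ) (a : Fin m → ℂ) :
    fderiv ℝ (X.chartMoment b φ v) u a =
      2 * X.pullOmega φ.symm u a (Complex.I • (cplx (latCoord b ℝ v) * u)) := by
  have hsm := X.contDiffOn_chartMoment h v
  refine eqOn_of_eq_of_forall_ne_zero φ.open_target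
    (f := fun u => fderiv ℝ (X.chartMoment b φ v) u a)
    (g := fun u => 2 * X.pullOmega φ.symm u a (Complex.I • (cplx (latCoord b ℝ v) * u)))
    ?_ ?_ (fun u hu hu0 => ?_) hu
  · exact (hsm.continuousOn_fderiv_of_isOpen φ.open_target (by simp)).clm_apply continuousOn_const
  · exact continuousOn_const.mul
      ((((X.contDiffOn_pullOmega_chart h.holomorphic).continuousOn).clm_apply
        continuousOn_const).clm_apply (by fun_prop))
  · obtain ⟨z, rfl⟩ := exists_orbitExp_eq b hu0
    -- Since `du_j = u_j dy_j`, where `y` are the logarithms of the chart coordinates, dividing by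
    -- the nonzero `u_j` lifts any tangent vector to logarithmic coordinates.
    obtain ⟨a', rfl⟩ : ∃ a', a = orbitExp b z * latCoord b ℂ a' := by
      refine ⟨(latCoord b ℂ).symm fun j => a j / orbitExp b z j, funext fun j => ?_⟩
      rw [LinearEquiv.apply_symm_apply, Pi.mul_apply, mul_div_cancel₀ _ (hu0 j)]
    have h1 : (fun z => X.pullOmega X.logMap z (cplx X.reeb) (Complex.I • cplx v)) =
        fun z => X.chartMoment b φ v (orbitExp b z) := by
      funext z
      rw [X.pullOmega_logMap h, map_smul, latCoord_cplx, latCoord_cplx, mul_comm,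
        mul_comm (orbitExp b z), smul_mul_assoc]
      rfl
    have h2 := X.fderiv_pullOmega_logMap_reeb_imag z a' v
    rw [h1] at h2
    have h3 : HasFDerivAt (X.chartMoment b φ v) _ (orbitExp b z) :=
      ((hsm.contDiffAt (φ.open_target.mem_nhds hu)).differentiableAt (by simp)).hasFDerivAt
    have h4 := h3.comp z (differentiableAt_orbitExp b z).hasFDerivAt
    have h5 : fderiv ℝ (fun z => X.chartMoment b φ v (orbitExp b z)) z a' =
        fderiv ℝ (X.chartMoment b φ v) (orbitExp b z) (fderiv ℝ (orbitExp b) z a') :=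
      congrArg (fun L : (Fin m → ℂ) →L[ℝ] ℝ => L a') h4.fderiv
    rw [fderiv_orbitExp] at h5
    rw [← h5, h2, X.pullOmega_logMap h, map_smul, latCoord_cplx, mul_smul_comm,
      mul_comm (orbitExp b z) (cplx _)]

/-- The real form is isotropic. -/
theorem pullOmega_real_real [T2Space S] (h : IsAffineToricChart X.J X.act X.base t b φ)
    {x : Fin m → ℝ} (hx : cplx x ∈ φ.target) (a c : Fin m → ℝ) :
    X.pullOmega φ.symm (cplx x) (cplx a) (cplx c) = 0 := by
  have hV : IsOpen (cplx ⁻¹' φ.target : Set (Fin m → ℝ)) :=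
    φ.open_target.preimage cplx.continuous
  refine eqOn_of_eq_of_forall_ne_zero hV
    (f := fun x => X.pullOmega φ.symm (cplx x) (cplx a) (cplx c)) (g := fun _ => (0 : ℝ))
    ?_ continuousOn_const (fun x hx hx0 => ?_) hx
  · exact ((((X.contDiffOn_pullOmega_chart h.holomorphic).continuousOn).comp
      cplx.continuous.continuousOn fun x hx => hx).clm_apply continuousOn_const).clm_apply
      continuousOn_const
  · have hx0' : ∀ j, cplx x j ≠ 0 := fun j => by simpa using hx0 j
    obtain ⟨z, hz⟩ := exists_orbitExp_eq b hx0'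
    -- At a real point with no zero coordinate, `i` times a real vector is tangent to the orbit of
    -- the compact torus. The `J`-invariance of ω thus turns real-real pairings into pairings along
    -- that isotropic orbit.
    have key : ∀ a : Fin m → ℝ, ∃ a' : Fin m → ℝ,
        Complex.I • cplx a = orbitExp b z * latCoord b ℂ (Complex.I • cplx a') := fun a => by
      refine ⟨(latCoord b ℝ).symm fun j => a j / x j, ?_⟩
      rw [map_smul, latCoord_cplx, LinearEquiv.apply_symm_apply, mul_smul_comm, hz]
      congr 1
      funext j
      have := hx0' j
      simp only [cplx_apply] at this
      simp only [cplx_apply, Pi.mul_apply, Complex.ofReal_div]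
      rw [mul_div_cancel₀ _ this]
    obtain ⟨a', ha'⟩ := key a
    obtain ⟨c', hc'⟩ := key c
    rw [← X.pullOmega_symm_I_I h hx, ha', hc', ← hz, ← X.pullOmega_logMap h,
      X.pullOmega_logMap_imag_imag]

end ToricKahlerCone

end ToricCone

/-! ### Stabilizers, and points of the real form -/

namespace ToricCone

variable {m : ℕ}

namespace ToricKahlerCone

variable {S : Type*} [TopologicalSpace S]
  [ChartedSpace (EuclideanSpace ℝ (Fin (2 * m - 1))) S] [IsManifold (𝓡 (2 * m - 1)) ∞ S]
variable (X : ToricKahlerCone m S) {t : Finset (Fin m → ℤ)}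
  {b : Module.Basis (Fin m) ℤ (Fin m → ℤ)} {φ : OpenPartialHomeomorph (Cone S) (Fin m → ℂ)}

/-- A vector whose generated field vanishes at a point lies in the span of the ray generators
that are orthogonal to the moment image of the point. -/
theorem mem_zSpan_of_mul_eq_zero (ht : t ∈ X.fan.cones)
    (h : IsAffineToricChart X.J X.act X.base t b φ) {u : Fin m → ℂ} (hu : u ∈ φ.target)
    {ζ : Fin m → ℝ} (hζ : cplx (latCoord b ℝ ζ) * u = 0) :
    ζ ∈ X.zSpan (X.moment (φ.symm u)) := by
  have h1 : ζ = ∑ j, latCoord b ℝ ζ j • toReal (b j) := by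
    conv_lhs => rw [← (latCoord b ℝ).symm_apply_apply ζ]
    funext k
    rw [latCoord_symm_apply]
    simp [toReal]
  rw [h1]
  refine Submodule.sum_mem _ fun j _ => ?_
  by_cases hj : latCoord b ℝ ζ j = 0
  · rw [hj, zero_smul]
    exact Submodule.zero_mem _
  have huj : u j = 0 := by
    have := congrFun hζ j
    simpa [hj] using this
  refine Submodule.smul_mem _ _ (Submodule.subset_span ⟨b j, ?_, ?_, rfl⟩)
  -- A coordinate may vanish on the chart only if its basis vector generates a ray of `t`; that ray
  -- is a face, hence belongs to the fan.
  · have hjt : b j ∈ t := by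
      by_contra hjt
      have h2 := hu
      rw [h.target_eq] at h2
      exact h2 j hjt huj
    exact X.fan.face t ht _ (Finset.singleton_subset_iff.2 hjt)
  -- The generator `b j` has coordinate vector `e_j`, so its field vanishes where `u_j = 0` and μ
  -- pairs to zero with it.
  · have h3 : cplx (latCoord b ℝ (toReal (b j))) * u = 0 := by
      rw [latCoord_toReal]
      funext k
      by_cases hk : k = j
      · subst hk
        simp [huj]
      · simp [hk]
    rw [X.moment_dotProduct h hu, chartMoment, h3, smul_zero, map_zero, mul_zero]

theorem sigma_eq_self_iff [T2Space S] (h : IsAffineToricChart X.J X.act X.base t b φ)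
    {u : Fin m → ℂ} (hu : u ∈ φ.target) :
    X.sigma (φ.symm u) = φ.symm u ↔ ∃ x, u = cplx x := by
  rw [X.sigma_symm h hu, ← conjVec_eq_self_iff]
  exact ⟨fun e => φ.symm.injOn (h.conjVec_mem_target hu) hu e, fun e => by rw [e]⟩

theorem pullOmega_symm_mul [T2Space S] (h : IsAffineToricChart X.J X.act X.base t b φ)
    {u : Fin m → ℂ} (hu : u ∈ φ.target) (y : Fin m → ℝ) (a c : Fin m → ℂ) :
    X.pullOmega φ.symm (orbitExp b (Complex.I • cplx y) * u)
      (orbitExp b (Complex.I • cplx y) * a) (orbitExp b (Complex.I • cplx y) * c) =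
      X.pullOmega φ.symm u a c := by
  set w := orbitExp b (Complex.I • cplx y) with hw
  have h1 := X.pullOmega_act 0 y (h.mdifferentiableAt_symm hu)
  rw [zero_smul, zero_add, mul_zero, Real.exp_zero, one_smul] at h1
  have h2 : (fun x => X.act (complexExp (Complex.I • cplx y)) (φ.symm x)) =ᶠ[𝓝 u]
      fun x => φ.symm (w * x) := by
    filter_upwards [φ.open_target.mem_nhds hu] with x hx using h.act_symm _ hx
  have hL : HasFDerivAt (fun x : Fin m → ℂ => w * x)
      (ContinuousLinearMap.mul ℝ (Fin m → ℂ) w) u :=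
    (ContinuousLinearMap.mul ℝ (Fin m → ℂ) w).hasFDerivAt
  rw [← h1, X.pullOmega_congr h2, X.pullOmega_comp (κ := fun x => w * x)
    (h.mdifferentiableAt_symm (h.mul_mem_target hu _)) hL.differentiableAt, hL.fderiv]
  rfl

theorem chartMoment_mul [T2Space S] (h : IsAffineToricChart X.J X.act X.base t b φ)
    {u : Fin m → ℂ} (hu : u ∈ φ.target) (y v : Fin m → ℝ) :
    X.chartMoment b φ v (orbitExp b (Complex.I • cplx y) * u) = X.chartMoment b φ v u := by
  unfold chartMoment
  rw [← X.pullOmega_symm_mul h hu y, mul_left_comm, mul_left_comm (cplx (latCoord b ℝ v)),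
    mul_smul_comm]

/-- Each value of the moment map is attained on the real form. -/
theorem exists_mem_realLevel [T2Space S] {ζ : Fin m → ℝ} {c : ℝ}
    (hne : (X.momentImage ∩ hyperplane ζ c).Nonempty) : (X.realLevel ζ c).Nonempty := by
  obtain ⟨_, ⟨p, rfl⟩, hp⟩ := hne
  obtain ⟨t, -, b, φ, h, hps⟩ := X.chart_cover p
  have hu := φ.map_source hps
  set u := φ p with hu'
  -- Taking moduli keeps the same coordinates nonzero and differs from `u` only by the compact torus
  -- element of the arguments, under which μ is invariant.
  set x : Fin m → ℝ := fun j => ‖u j‖ with hx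
  have hxV : cplx x ∈ φ.target := by
    have h2 := hu
    rw [h.target_eq] at h2 ⊢
    intro j hj
    simpa [hx] using h2 j hj
  set y : Fin m → ℝ := (latCoord b ℝ).symm fun j => (u j).arg with hy
  have h1 : u = orbitExp b (Complex.I • cplx y) * cplx x := by
    funext j
    rw [orbitExp, map_smul, latCoord_cplx, hy, LinearEquiv.apply_symm_apply]
    have := Complex.norm_mul_exp_arg_mul_I (u j)
    rw [← this]
    simp [hx, mul_comm]
  refine ⟨φ.symm (cplx x), (X.sigma_eq_self_iff h hxV).2 ⟨x, rfl⟩, ?_⟩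
  rw [X.moment_dotProduct h hxV, ← X.chartMoment_mul h hxV y, ← h1,
    ← X.moment_dotProduct h hu, φ.left_inv hps]
  exact hp

theorem actDeriv_coneDeriv (h : IsAffineToricChart X.J X.act X.base t b φ)
    {u : Fin m → ℂ} (hu : u ∈ φ.target) (z a : Fin m → ℂ) :
    X.actDeriv (complexExp z) (φ.symm u) (coneDeriv m φ.symm u a) =
      coneDeriv m φ.symm (orbitExp b z * u) (orbitExp b z * a) := by
  rw [← X.coneDeriv_act _ (h.mdifferentiableAt_symm hu)]
  have h2 : (fun x => X.act (complexExp z) (φ.symm x)) =ᶠ[𝓝 u]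
      fun x => φ.symm (orbitExp b z * x) := by
    filter_upwards [φ.open_target.mem_nhds hu] with x hx using h.act_symm _ hx
  have hL : HasFDerivAt (fun x : Fin m → ℂ => orbitExp b z * x)
      (ContinuousLinearMap.mul ℝ (Fin m → ℂ) (orbitExp b z)) u :=
    (ContinuousLinearMap.mul ℝ (Fin m → ℂ) (orbitExp b z)).hasFDerivAt
  rw [coneDeriv_congr h2, coneDeriv_comp (κ := fun x => orbitExp b z * x)
    (h.mdifferentiableAt_symm (h.mul_mem_target hu _)) hL.differentiableAt, hL.fderiv]
  rfl

end ToricKahlerCone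

/-! ### The holomorphic volume form in affine charts -/

namespace ToricAlmostCYCone

variable {S : Type*} [TopologicalSpace S]
  [ChartedSpace (EuclideanSpace ℝ (Fin (2 * m - 1))) S] [IsManifold (𝓡 (2 * m - 1)) ∞ S]
variable (X : ToricAlmostCYCone m S) {t : Finset (Fin m → ℤ)}
  {b : Module.Basis (Fin m) ℤ (Fin m → ℤ)} {φ : OpenPartialHomeomorph (Cone S) (Fin m → ℂ)}

/-- The holomorphic volume form on the model space. -/
def flatOmega (p : Cone S) : ConeE m [⋀^Fin m]→ₗ[ℝ] ℂ := X.Omega p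

/-- The character of `T_ℂᵐ` given by `γ`, on the Lie algebra. -/
def character (z : Fin m → ℂ) : ℂ := Complex.exp (∑ k, (X.gamma k : ℂ) * z k)

theorem character_add (z w : Fin m → ℂ) :
    X.character (z + w) = X.character z * X.character w := by
  simp [character, mul_add, Finset.sum_add_distrib, Complex.exp_add]

theorem character_conjVec (z : Fin m → ℂ) :
    X.character (conjVec z) = (starRingEnd ℂ) (X.character z) := by
  simp [character, ← Complex.exp_conj, map_sum]

/-- The coefficient `k` of Ω in the chart is pinned down on the open orbit by its prescribed form
there. Density then gives the two properties that govern the phase: it transforms by the character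
γ, up to the Jacobian of the multiplication, and it commutes with conjugation, so it is real at real
points. -/
theorem exists_flatOmega_eq (h : IsAffineToricChart X.J X.act X.base t b φ) :
    ∃ k : (Fin m → ℂ) → ℂ, ContinuousOn k φ.target ∧ (∀ u ∈ φ.target, k u ≠ 0) ∧
      (∀ u ∈ φ.target, ∀ a : Fin m → Fin m → ℂ,
        X.flatOmega (φ.symm u) (fun i => coneDeriv m φ.symm u (a i)) =
          k u * Matrix.det (Matrix.of a)) ∧
      (∀ z, ∀ u ∈ φ.target,
        k (orbitExp b z * u) * ∏ j, orbitExp b z j = X.character z * k u) ∧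
      (∀ u ∈ φ.target, k (conjVec u) = (starRingEnd ℂ) (k u)) := by
  obtain ⟨k, hk, hk0, hkΩ⟩ := X.Omega_holomorphic φ h.holomorphic
  have hΩ : ∀ u ∈ φ.target, ∀ a : Fin m → Fin m → ℂ,
      X.flatOmega (φ.symm u) (fun i => coneDeriv m φ.symm u (a i)) =
        k u * Matrix.det (Matrix.of a) := fun u hu a => by
    have h1 := hkΩ _ (φ.map_target hu) fun i => coneDeriv m φ.symm u (a i)
    rw [φ.right_inv hu] at h1
    refine h1.trans ?_
    congr 3
    funext i
    exact h.holomorphic.chartDeriv_coneDeriv hu (a i)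
  -- `D` is the Jacobian determinant of passing from the `z^k` to lattice coordinates; its entries
  -- are integers, hence it is real.
  set D : ℂ := Matrix.det (Matrix.of fun i j : Fin m => latCoord b ℂ (Pi.single i 1) j) with hD
  have hDc : (starRingEnd ℂ) D = D := by
    rw [hD, RingHom.map_det]
    congr 1
    ext i j
    simp [latCoord_apply, Pi.single_apply]
  have key : ∀ z, k (orbitExp b z) * ((∏ j, orbitExp b z j) * D) = X.character z := fun z => by
    have h1 := X.Omega_orbit z fun i => Pi.single i 1
    have h2 : X.flatOmega (X.logMap z) (fun i => coneDeriv m X.logMap z (Pi.single i 1)) =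
        X.character z := by
      refine h1.trans ?_
      have : (Matrix.of fun i j : Fin m => (Pi.single i (1 : ℂ) : Fin m → ℂ) j) = 1 := by
        ext i j
        simp [Matrix.one_apply, Pi.single_apply, eq_comm]
      rw [this, Matrix.det_one, mul_one]
      rfl
    simp only [X.coneDeriv_logMap h] at h2
    rw [X.logMap_eq h] at h2
    have h3 := hΩ (orbitExp b z) (h.expVec_mem_target _)
      fun i => orbitExp b z * latCoord b ℂ (Pi.single i 1)
    rw [← h2]
    refine Eq.trans ?_ h3.symm
    congr 1
    exact (Matrix.det_mul_row (orbitExp b z)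
      (Matrix.of fun i j : Fin m => latCoord b ℂ (Pi.single i 1) j)).symm
  have hchar : ∀ z, X.character z ≠ 0 := fun z => Complex.exp_ne_zero _
  -- Nonvanishing of the character gives `D ≠ 0` without computing the determinant.
  have hD0 : D ≠ 0 := fun h0 => hchar 0 (by rw [← key 0, h0, mul_zero, mul_zero])
  have hP : ∀ z, ∏ j, orbitExp b z j ≠ 0 := fun z =>
    Finset.prod_ne_zero_iff.2 fun j _ => orbitExp_ne_zero b z j
  have hkc : ContinuousOn k φ.target := hk.continuousOn
  refine ⟨k, hkc, hk0, hΩ, fun z u hu => ?_, fun u hu => ?_⟩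
  · refine eqOn_of_eq_of_forall_ne_zero φ.open_target
      (f := fun u => k (orbitExp b z * u) * ∏ j, orbitExp b z j)
      (g := fun u => X.character z * k u) ?_ (continuousOn_const.mul hkc) (fun u hu hu0 => ?_) hu
    · refine (hkc.comp (by fun_prop) fun u hu => h.mul_mem_target hu _).mul continuousOn_const
    · obtain ⟨w, rfl⟩ := exists_orbitExp_eq b hu0
      have e1 := key (z + w)
      have e2 := key w
      rw [orbitExp_add, X.character_add, ← e2] at e1
      simp only [Pi.mul_apply, Finset.prod_mul_distrib] at e1
      refine mul_right_cancel₀ (mul_ne_zero (hP w) hD0) ?_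
      linear_combination e1
  · refine eqOn_of_eq_of_forall_ne_zero φ.open_target
      (f := fun u => k (conjVec u)) (g := fun u => (starRingEnd ℂ) (k u)) ?_ ?_
      (fun u hu hu0 => ?_) hu
    · exact hkc.comp (by fun_prop) fun u hu => h.conjVec_mem_target hu
    · exact Complex.continuous_conj.comp_continuousOn hkc
    · obtain ⟨w, rfl⟩ := exists_orbitExp_eq b hu0
      have e1 := key (conjVec w)
      have e2 := congrArg (starRingEnd ℂ) (key w)
      rw [X.character_conjVec, ← e2, ← conjVec_orbitExp] at e1
      simp only [map_mul, map_prod, hDc, conjVec_apply] at e1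
      refine mul_right_cancel₀ (b := (∏ j, (starRingEnd ℂ) (orbitExp b w j)) * D) ?_ e1
      rw [← map_prod]
      exact mul_ne_zero ((map_ne_zero _).2 (hP w)) hD0

theorem flatOmega_act (z : Fin m → ℂ) (p : Cone S) (v : Fin m → ConeE m) :
    X.flatOmega (X.act (complexExp z) p) (fun i => X.actDeriv (complexExp z) p (v i)) =
      X.character z * X.flatOmega p v := by
  obtain ⟨t, -, b, φ, h, hp⟩ := X.chart_cover p
  obtain ⟨k, -, -, hΩ, hk, -⟩ := X.exists_flatOmega_eq h
  obtain ⟨u, hu, rfl⟩ : ∃ u ∈ φ.target, φ.symm u = p := ⟨φ p, φ.map_source hp, φ.left_inv hp⟩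
  obtain ⟨a, rfl⟩ : ∃ a : Fin m → Fin m → ℂ, v = fun i => coneDeriv m φ.symm u (a i) :=
    ⟨fun i => chartDeriv φ (φ.symm u) (v i), funext fun i => by
      have := h.holomorphic.coneDeriv_chartDeriv hp (v i)
      rw [φ.right_inv hu] at this
      exact this.symm⟩
  have h1 := hΩ _ (h.mul_mem_target hu (latCoord b ℂ z)) fun i => orbitExp b z * a i
  have h3 : Matrix.det (Matrix.of fun i => orbitExp b z * a i) =
      (∏ j, orbitExp b z j) * Matrix.det (Matrix.of a) := Matrix.det_mul_row _ _
  simp only [X.actDeriv_coneDeriv h hu]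
  rw [h.act_symm z hu]
  refine h1.trans ?_
  rw [hΩ _ hu a, h3, ← mul_assoc, ← mul_assoc, ← hk z _ hu]
  rfl

end ToricAlmostCYCone

end ToricCone

/-! ### Straightening a regular level set -/

namespace ToricCone

variable {m : ℕ}

/-- Split `ℝᵐ` as the kernel of `ℓ` plus a line spanned by `n` with `ℓ n = 1`, and identify the
kernel with `ℝ^{m-1}` by dimension; `0 < m` keeps the truncated subtraction honest. -/
theorem exists_continuousLinearEquiv_snd_eq (hm : 0 < m) {ℓ : (Fin m → ℝ) →L[ℝ] ℝ} (hℓ : ℓ ≠ 0) :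
    ∃ T : (Fin m → ℝ) ≃L[ℝ] EuclideanSpace ℝ (Fin (m - 1)) × ℝ, ∀ x, (T x).2 = ℓ x := by
  have hℓ' : (ℓ : (Fin m → ℝ) →ₗ[ℝ] ℝ) ≠ 0 := fun h0 => hℓ (ContinuousLinearMap.coe_injective h0)
  have hfin := Module.Dual.finrank_ker_add_one_of_ne_zero hℓ'
  obtain ⟨n, hn⟩ : ∃ n, ℓ n = 1 := by
    obtain ⟨n, hn⟩ := DFunLike.ne_iff.1 hℓ
    exact ⟨(ℓ n)⁻¹ • n, by simpa using inv_mul_cancel₀ hn⟩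
  set K := LinearMap.ker (ℓ : (Fin m → ℝ) →ₗ[ℝ] ℝ)
  have hK : Module.finrank ℝ K = Module.finrank ℝ (EuclideanSpace ℝ (Fin (m - 1))) := by
    simp at hfin ⊢
    omega
  let P : (Fin m → ℝ) →ₗ[ℝ] K := LinearMap.codRestrict K
    (LinearMap.id - (ℓ : (Fin m → ℝ) →ₗ[ℝ] ℝ).smulRight n) fun x => by
      simp [K, hn]
  let T₀ : (Fin m → ℝ) →ₗ[ℝ] EuclideanSpace ℝ (Fin (m - 1)) × ℝ :=
    ((LinearEquiv.ofFinrankEq _ _ hK).toLinearMap ∘ₗ P).prod (ℓ : (Fin m → ℝ) →ₗ[ℝ] ℝ)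
  have hinj : Function.Injective T₀ := by
    refine (injective_iff_map_eq_zero T₀).2 fun x hx => ?_
    have h2 : ℓ x = 0 := congrArg Prod.snd hx
    have h1 : P x = 0 := (LinearEquiv.map_eq_zero_iff _).1 (congrArg Prod.fst hx)
    have h3 : x - ℓ x • n = 0 := congrArg Subtype.val h1
    simpa [h2] using h3
  have hd : Module.finrank ℝ (Fin m → ℝ) =
      Module.finrank ℝ (EuclideanSpace ℝ (Fin (m - 1)) × ℝ) := by
    simp
    omega
  exact ⟨(LinearEquiv.ofInjectiveOfFinrankEq T₀ hinj hd).toContinuousLinearEquiv, fun x => rfl⟩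

/-- A smooth function near a regular point is the last coordinate of a chart whose other
coordinates are linear. -/
theorem exists_openPartialHomeomorph_of_regular (hm : 0 < m) {g : (Fin m → ℝ) → ℝ}
    {V : Set (Fin m → ℝ)} (hV : IsOpen V) (hg : ContDiffOn ℝ ∞ g V) {x₀ : Fin m → ℝ}
    (hx₀ : x₀ ∈ V) (hreg : fderiv ℝ g x₀ ≠ 0) :
    ∃ (e : OpenPartialHomeomorph (Fin m → ℝ) (EuclideanSpace ℝ (Fin (m - 1)) × ℝ))
      (L : (Fin m → ℝ) →L[ℝ] EuclideanSpace ℝ (Fin (m - 1))),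
      x₀ ∈ e.source ∧ e.source ⊆ V ∧ (∀ x ∈ e.source, e x = (L x, g x)) ∧
        ContDiffOn ℝ ∞ e.symm e.target := by
  obtain ⟨T, hT⟩ := exists_continuousLinearEquiv_snd_eq hm hreg
  set L : (Fin m → ℝ) →L[ℝ] EuclideanSpace ℝ (Fin (m - 1)) :=
    (ContinuousLinearMap.fst ℝ _ ℝ).comp (T : (Fin m → ℝ) →L[ℝ] _) with hL
  set H : (Fin m → ℝ) → EuclideanSpace ℝ (Fin (m - 1)) × ℝ := fun x => (L x, g x) with hH
  have hHs : ContDiffOn ℝ ∞ H V := L.contDiff.contDiffOn.prodMk hg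
  have hHat : ∀ x ∈ V, ContDiffAt ℝ ∞ H x := fun x hx => hHs.contDiffAt (hV.mem_nhds hx)
  have hder : HasFDerivAt H (T : (Fin m → ℝ) →L[ℝ] _) x₀ := by
    have h1 := L.hasFDerivAt (x := x₀)
    have h2 := ((hg.contDiffAt (hV.mem_nhds hx₀)).differentiableAt (by simp)).hasFDerivAt
    refine (h1.prodMk h2).congr_fderiv ?_
    ext1 x
    exact Prod.ext rfl (hT x).symm
  set e₀ := (hHat x₀ hx₀).toOpenPartialHomeomorph H hder (by simp) with he₀
  -- The inverse is smooth at the image of each point where `dH` is invertible. Invertibility is an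
  -- open condition, so restricting to `O` makes the inverse smooth on the whole target.
  set O : Set (Fin m → ℝ) := V ∩ fderiv ℝ H ⁻¹'
    range ((↑) : ((Fin m → ℝ) ≃L[ℝ] EuclideanSpace ℝ (Fin (m - 1)) × ℝ) →
      (Fin m → ℝ) →L[ℝ] EuclideanSpace ℝ (Fin (m - 1)) × ℝ) with hO
  have hOo : IsOpen O := (hHs.continuousOn_fderiv_of_isOpen hV (by simp)).isOpen_inter_preimage
    hV ContinuousLinearEquiv.isOpen
  have hx₀O : x₀ ∈ O := ⟨hx₀, T, hder.fderiv.symm⟩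
  have hsrc : (e₀.restrOpen O hOo).source = e₀.source ∩ O := rfl
  refine ⟨e₀.restrOpen O hOo, L, ⟨?_, hx₀O⟩, fun x hx => hx.2.1, fun x _ => rfl, ?_⟩
  · exact (hHat x₀ hx₀).mem_toOpenPartialHomeomorph_source hder (by simp)
  · intro y hy
    have hxs := (e₀.restrOpen O hOo).map_target hy
    obtain ⟨T', hT'⟩ := hxs.2.2
    refine ((e₀.restrOpen O hOo).contDiffAt_symm hy (f₀' := T') ?_ ?_).contDiffWithinAt
    · have := ((hHat _ hxs.2.1).differentiableAt (by simp)).hasFDerivAt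
      rw [← hT'] at this
      exact this
    · exact hHat _ hxs.2.1

end ToricCone

/-! ### The real level set as a submanifold -/

namespace ToricCone

variable {m : ℕ}

/-- The real part of a complex vector. -/
def reVec : (Fin m → ℂ) →L[ℝ] (Fin m → ℝ) :=
  ContinuousLinearMap.pi fun k => Complex.reCLM.comp (ContinuousLinearMap.proj k)

@[simp] theorem reVec_cplx (x : Fin m → ℝ) : reVec (cplx x) = x :=
  funext fun _ => Complex.ofReal_re _

theorem cplx_injective : Function.Injective (cplx : (Fin m → ℝ) → Fin m → ℂ) :=
  Function.LeftInverse.injective reVec_cplx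

theorem cplx_mul (x y : Fin m → ℝ) : cplx (x * y) = cplx x * cplx y :=
  funext fun _ => Complex.ofReal_mul _ _

namespace ToricKahlerCone

variable {S : Type*} [TopologicalSpace S]
  [ChartedSpace (EuclideanSpace ℝ (Fin (2 * m - 1))) S] [IsManifold (𝓡 (2 * m - 1)) ∞ S]
variable (X : ToricKahlerCone m S) {t : Finset (Fin m → ℤ)}
  {b : Module.Basis (Fin m) ℤ (Fin m → ℤ)} {φ : OpenPartialHomeomorph (Cone S) (Fin m → ℂ)}

theorem symm_mem_realLevel_iff [T2Space S] (h : IsAffineToricChart X.J X.act X.base t b φ)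
    {x : Fin m → ℝ} (hx : cplx x ∈ φ.target) (ζ : Fin m → ℝ) (c : ℝ) :
    φ.symm (cplx x) ∈ X.realLevel ζ c ↔ X.chartMoment b φ ζ (cplx x) = 2 * c := by
  have h1 := X.moment_dotProduct h hx ζ
  constructor
  · rintro ⟨-, h2⟩
    rw [h2] at h1
    linarith
  · intro h2
    refine ⟨(X.sigma_eq_self_iff h hx).2 ⟨x, rfl⟩, ?_⟩
    rw [h1, h2]
    ring

theorem apply_eq_cplx_of_mem_realLevel [T2Space S]
    (h : IsAffineToricChart X.J X.act X.base t b φ) {p : Cone S} (hp : p ∈ φ.source)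
    {ζ : Fin m → ℝ} {c : ℝ} (hpA : p ∈ X.realLevel ζ c) : φ p = cplx (reVec (φ p)) := by
  obtain ⟨x, hx⟩ := (X.sigma_eq_self_iff h (φ.map_source hp)).1 (by
    rw [φ.left_inv hp]
    exact hpA.1)
  rw [hx, reVec_cplx]

/-- The field generated by `ζ` does not vanish along the level set. -/
theorem latCoord_mul_ne_zero [T2Space S] (ht : t ∈ X.fan.cones)
    (h : IsAffineToricChart X.J X.act X.base t b φ) {ζ : Fin m → ℝ} {c : ℝ}
    (hSpan : ∀ y ∈ X.momentImage ∩ hyperplane ζ c, ζ ∉ X.zSpan y) {x : Fin m → ℝ}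
    (hx : cplx x ∈ φ.target) (hxA : φ.symm (cplx x) ∈ X.realLevel ζ c) :
    latCoord b ℝ ζ * x ≠ 0 := by
  intro h0
  refine hSpan (X.moment (φ.symm (cplx x))) ⟨⟨_, rfl⟩, hxA.2⟩ ?_
  refine X.mem_zSpan_of_mul_eq_zero ht h hx ?_
  rw [← cplx_mul, h0, map_zero]

theorem fderiv_chartMoment_cplx [T2Space S] (h : IsAffineToricChart X.J X.act X.base t b φ)
    {x : Fin m → ℝ} (hx : cplx x ∈ φ.target) (v a : Fin m → ℝ) :
    fderiv ℝ (fun x => X.chartMoment b φ v (cplx x)) x a =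
      2 * X.pullOmega φ.symm (cplx x) (cplx a) (Complex.I • cplx (latCoord b ℝ v * x)) := by
  have h1 : HasFDerivAt (X.chartMoment b φ v) _ (cplx x) :=
    (((X.contDiffOn_chartMoment h v).contDiffAt
      (φ.open_target.mem_nhds hx)).differentiableAt (by simp)).hasFDerivAt
  have h2 := h1.comp x (cplx.hasFDerivAt (x := x))
  have h3 := congrArg (fun L : (Fin m → ℝ) →L[ℝ] ℝ => L a) h2.fderiv
  refine h3.trans ?_
  rw [cplx_mul]
  exact X.fderiv_chartMoment h hx v (cplx a)

/-- In a real toric chart the set is a regular level of `⟨μ, ζ⟩`, so the straightening chart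
parametrizes it. -/
theorem isEmbeddedSubmanifold_realLevel [T2Space S] (hm : 0 < m) {ζ : Fin m → ℝ} {c : ℝ}
    (hSpan : ∀ y ∈ X.momentImage ∩ hyperplane ζ c, ζ ∉ X.zSpan y) :
    IsEmbeddedSubmanifold m (m - 1) (X.realLevel ζ c) := by
  classical
  intro p
  obtain ⟨t, ht, b, φ, h, hp⟩ := X.chart_cover p
  set V : Set (Fin m → ℝ) := cplx ⁻¹' φ.target with hV
  have hVo : IsOpen V := φ.open_target.preimage cplx.continuous
  set g : (Fin m → ℝ) → ℝ := fun x => X.chartMoment b φ ζ (cplx x) with hg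
  have hgs : ContDiffOn ℝ ∞ g V :=
    (X.contDiffOn_chartMoment h ζ).comp cplx.contDiff.contDiffOn fun x hx => hx
  set x₀ := reVec (φ p) with hx₀
  have hφp : φ p = cplx x₀ := X.apply_eq_cplx_of_mem_realLevel h hp p.2
  have hx₀V : x₀ ∈ V := by
    change cplx x₀ ∈ φ.target
    rw [← hφp]
    exact φ.map_source hp
  have hpx : φ.symm (cplx x₀) = p := by rw [← hφp, φ.left_inv hp]
  -- The derivative is tested on `n = ζ · x₀`: it equals `2 ω(n, i n)`, twice the squared length of
  -- `n`.
  have hreg : fderiv ℝ g x₀ ≠ 0 := fun h0 => by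
    have hn := X.latCoord_mul_ne_zero ht h hSpan hx₀V (by rw [hpx]; exact p.2)
    have h1 := X.fderiv_chartMoment_cplx h hx₀V ζ (latCoord b ℝ ζ * x₀)
    rw [← hg, h0] at h1
    have h2 := X.pullOmega_symm_I_pos h hx₀V
      (a := cplx (latCoord b ℝ ζ * x₀)) fun e => hn (cplx_injective (e.trans (map_zero _).symm))
    simp only [zero_apply] at h1
    linarith
  obtain ⟨e, L, hx₀e, heV, heq, hes⟩ :=
    exists_openPartialHomeomorph_of_regular hm hVo hgs hx₀V hreg
  -- The level is `2 * c` because `chartMoment` is twice the moment component.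
  set κ : EuclideanSpace ℝ (Fin (m - 1)) → Fin m → ℝ := fun y => e.symm (y, 2 * c) with hκ
  set O : Set (EuclideanSpace ℝ (Fin (m - 1))) := {y | (y, 2 * c) ∈ e.target} with hO
  have hOo : IsOpen O := e.open_target.preimage (by fun_prop)
  have hκs : ContDiffOn ℝ ∞ κ O := hes.comp (by fun_prop) fun y hy => hy
  have hκe : ∀ y ∈ O, κ y ∈ e.source := fun y hy => e.map_target hy
  have hκV : ∀ y ∈ O, cplx (κ y) ∈ φ.target := fun y hy => heV (hκe y hy)
  have hκL : ∀ y ∈ O, L (κ y) = y ∧ g (κ y) = 2 * c := fun y hy => by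
    have h1 := heq _ (hκe y hy)
    rw [e.right_inv hy] at h1
    exact ⟨(congrArg Prod.fst h1).symm, (congrArg Prod.snd h1).symm⟩
  have hκA : ∀ y ∈ O, φ.symm (cplx (κ y)) ∈ X.realLevel ζ c := fun y hy =>
    (X.symm_mem_realLevel_iff h (hκV y hy) ζ c).2 (hκL y hy).2
  have hgA : ∀ q : X.realLevel ζ c, (q : Cone S) ∈ φ.source → reVec (φ q) ∈ e.source →
      e (reVec (φ q)) = (L (reVec (φ q)), 2 * c) := fun q hq hqe => by
    rw [heq _ hqe]
    congr 1
    refine (X.symm_mem_realLevel_iff h (heV hqe) ζ c).1 ?_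
    rw [← X.apply_eq_cplx_of_mem_realLevel h hq q.2, φ.left_inv hq]
    exact q.2
  let Q : EuclideanSpace ℝ (Fin (m - 1)) → X.realLevel ζ c := fun y =>
    if hy : y ∈ O then ⟨φ.symm (cplx (κ y)), hκA y hy⟩ else p
  have hQ : ∀ y ∈ O, (Q y : Cone S) = φ.symm (cplx (κ y)) := fun y hy => by
    simp only [Q, dif_pos hy]
  have hsm : ContMDiffOn 𝓘(ℝ, EuclideanSpace ℝ (Fin (m - 1))) (coneI m) ∞
      (fun y => φ.symm (cplx (κ y))) O :=
    h.holomorphic.smooth_symm.comp (cplx.contDiff.comp_contDiffOn hκs).contMDiffOn hκV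
  let ψ : OpenPartialHomeomorph (EuclideanSpace ℝ (Fin (m - 1))) (X.realLevel ζ c) :=
    { toFun := Q
      invFun := fun q => L (reVec (φ q))
      source := O
      target := {q | (q : Cone S) ∈ φ.source ∩ φ ⁻¹' (reVec ⁻¹' e.source)}
      map_source' := fun y hy => by
        simp only [mem_ofPred_eq, mem_inter_iff, mem_preimage, hQ y hy]
        rw [φ.right_inv (hκV y hy), reVec_cplx]
        exact ⟨φ.map_target (hκV y hy), hκe y hy⟩
      map_target' := fun q hq => by
        change (L (reVec (φ q)), 2 * c) ∈ e.target
        rw [← hgA q hq.1 hq.2]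
        exact e.map_source hq.2
      left_inv' := fun y hy => by
        rw [hQ y hy, φ.right_inv (hκV y hy), reVec_cplx]
        exact (hκL y hy).1
      right_inv' := fun q hq => by
        have h1 : (L (reVec (φ q)), 2 * c) ∈ e.target := by
          rw [← hgA q hq.1 hq.2]
          exact e.map_source hq.2
        refine Subtype.ext ?_
        rw [hQ _ h1]
        simp only [hκ]
        rw [← hgA q hq.1 hq.2, e.left_inv hq.2,
          ← X.apply_eq_cplx_of_mem_realLevel h hq.1 q.2, φ.left_inv hq.1]
      open_source := hOo
      open_target := (φ.continuousOn.isOpen_inter_preimage φ.open_source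
        (e.open_source.preimage reVec.continuous)).preimage continuous_subtype_val
      continuousOn_toFun := by
        rw [Topology.IsInducing.subtypeVal.continuousOn_iff]
        exact hsm.continuousOn.congr hQ
      continuousOn_invFun := by
        refine (L.continuous.comp reVec.continuous).comp_continuousOn ?_
        exact φ.continuousOn.comp continuous_subtype_val.continuousOn fun q hq => hq.1 }
  refine ⟨ψ, ⟨hsm.congr hQ, fun y hy => ?_⟩, ?_⟩
  · have hev : (fun y => (ψ y : Cone S)) =ᶠ[𝓝 y] fun y => φ.symm (cplx (κ y)) := by
      filter_upwards [hOo.mem_nhds hy] with y' hy' using hQ y' hy'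
    change Function.Injective (coneDeriv m (fun y => (ψ y : Cone S)) y)
    rw [coneDeriv_congr hev]
    have hκd : HasFDerivAt κ (fderiv ℝ κ y) y :=
      ((hκs.contDiffAt (hOo.mem_nhds hy)).differentiableAt (by simp)).hasFDerivAt
    have hcd := (cplx (m := m)).hasFDerivAt.comp y hκd
    -- The linear map `L` is a left inverse of `κ`, hence of its derivative; this gives the
    -- immersion.
    have h1 : ∀ a, L (fderiv ℝ κ y a) = a := fun a => by
      have e1 := L.hasFDerivAt.comp y hκd
      have e2 : (L ∘ κ) =ᶠ[𝓝 y] id := by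
        filter_upwards [hOo.mem_nhds hy] with y' hy' using (hκL y' hy').1
      exact congrArg (fun T : EuclideanSpace ℝ (Fin (m - 1)) →L[ℝ] _ => T a)
        (e1.unique ((hasFDerivAt_id y).congr_of_eventuallyEq e2))
    refine (injective_iff_map_eq_zero _).2 fun a ha => ?_
    rw [coneDeriv_comp (κ := fun y => cplx (κ y)) (h.mdifferentiableAt_symm (hκV y hy))
      hcd.differentiableAt] at ha
    have e3 := h.injective_coneDeriv (hκV y hy) (ha.trans (map_zero _).symm)
    have e4 : fderiv ℝ (fun y => cplx (κ y)) y a = cplx (fderiv ℝ κ y a) :=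
      congrArg (fun T : EuclideanSpace ℝ (Fin (m - 1)) →L[ℝ] _ => T a) hcd.fderiv
    rw [e4] at e3
    have e5 := cplx_injective (e3.trans (map_zero _).symm)
    rw [← h1 a, e5, map_zero]
  · exact ⟨hp, hx₀e⟩

end ToricKahlerCone

end ToricCone

/-! ### Determinants and arguments modulo π -/

namespace ToricCone

variable {m : ℕ}

/-- An alternating map of top degree is determined by its value on a basis. -/
theorem alternatingMap_apply_eq_det_smul {M N : Type*} [AddCommGroup M] [Module ℝ M]
    [AddCommGroup N] [Module ℝ N] (e : Module.Basis (Fin m) ℝ M) (f : M [⋀^Fin m]→ₗ[ℝ] N)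
    (v : Fin m → M) : f v = e.det v • f e := by
  have h : f = (LinearMap.toSpanSingleton ℝ N (f e)).compAlternatingMap e.det := by
    refine Module.Basis.ext_alternating e fun i h => ?_
    let σ : Equiv.Perm (Fin m) := Equiv.ofBijective i (Finite.injective_iff_bijective.1 h)
    change f (e ∘ σ) = (LinearMap.toSpanSingleton ℝ N (f e)).compAlternatingMap e.det (e ∘ σ)
    simp [AlternatingMap.map_perm, Module.Basis.det_self]
  conv_lhs => rw [h]
  rfl

/-- On a basis adapted to the product, `c` multiplies exactly one row, the one of the `ℝ` factor.
Both sides are real alternating forms of top degree in the basis, so the identity holds for every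
basis. With `c` purely imaginary it produces the phase π/2. -/
theorem det_add_smul (hm : 0 < m) (A : EuclideanSpace ℝ (Fin (m - 1)) →ₗ[ℝ] (Fin m → ℝ))
    (n : Fin m → ℝ) (e : Module.Basis (Fin m) ℝ (EuclideanSpace ℝ (Fin (m - 1)) × ℝ)) (c : ℂ) :
    Matrix.det (Matrix.of fun i => cplx (A (e i).1) + (c * (e i).2) • cplx n) =
      c * (Matrix.det (Matrix.of fun i => A (e i).1 + (e i).2 • n) : ℝ) := by
  let T : ℂ → (EuclideanSpace ℝ (Fin (m - 1)) × ℝ) →ₗ[ℝ] (Fin m → ℂ) := fun c =>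
    { toFun := fun v => cplx (A v.1) + (c * v.2) • cplx n
      map_add' := fun v w => by
        simp only [Prod.fst_add, Prod.snd_add, map_add, Complex.ofReal_add, mul_add, add_smul]
        abel
      map_smul' := fun r v => by
        simp only [Prod.smul_fst, Prod.smul_snd, map_smul, smul_eq_mul, Complex.ofReal_mul,
          RingHom.id_apply, smul_add]
        congr 1
        funext k
        simp
        ring }
  let D : ℂ → (EuclideanSpace ℝ (Fin (m - 1)) × ℝ) [⋀^Fin m]→ₗ[ℝ] ℂ := fun c =>
    { ((Matrix.detRowAlternating (n := Fin m) (R := ℂ)).toMultilinearMap.restrictScalars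
        ℝ).compLinearMap fun _ => T c with
      map_eq_zero_of_eq' := fun v i j hij hne =>
        (Matrix.detRowAlternating (n := Fin m) (R := ℂ)).map_eq_zero_of_eq _
          (congrArg (T c) hij) hne }
  have hD : ∀ c v, D c v = Matrix.det (Matrix.of fun i => cplx (A (v i).1) +
      (c * (v i).2) • cplx n) := fun c v => rfl
  obtain ⟨σ⟩ : Nonempty (Fin (m - 1) ⊕ Unit ≃ Fin m) :=
    Fintype.card_eq.1 (by simp; omega)
  let e' : Module.Basis (Fin m) ℝ (EuclideanSpace ℝ (Fin (m - 1)) × ℝ) :=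
    ((EuclideanSpace.basisFun (Fin (m - 1)) ℝ).toBasis.prod
      (Module.Basis.singleton Unit ℝ)).reindex σ
  have h1 : D c e' = c * D 1 e' := by
    rw [hD, hD]
    have h2 : (Matrix.of fun i => cplx (A (e' i).1) + (c * (e' i).2) • cplx n) =
        Matrix.of fun i j => (if i = σ (Sum.inr ()) then c else 1) *
          (Matrix.of fun i => cplx (A (e' i).1) + (1 * ((e' i).2 : ℂ)) • cplx n) i j := by
      ext i j
      obtain ⟨i, rfl⟩ := σ.surjective i
      rcases i with i | i
      · simp [e']
      · simp [e']
    rw [h2, Matrix.det_mul_column]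
    simp
  have h3 : ∀ c, D c e = e'.det e * D c e' := fun c =>
    (alternatingMap_apply_eq_det_smul e' (D c) e).trans (Complex.real_smul)
  rw [← hD, h3, h1]
  have h4 := h3 1
  rw [hD] at h4
  have h5 : (Matrix.det (Matrix.of fun i => A (e i).1 + (e i).2 • n) : ℝ) =
      Matrix.det (Matrix.of fun i => cplx (A (e i).1) + (1 * ((e i).2 : ℂ)) • cplx n) := by
    rw [← Complex.ofRealHom_eq_coe, RingHom.map_det]
    congr 1
    ext i j
    simp
  rw [h5, h4]
  ring

theorem det_add_smul_ne_zero {A : EuclideanSpace ℝ (Fin (m - 1)) →ₗ[ℝ] (Fin m → ℝ)}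
    {n : Fin m → ℝ} (hinj : ∀ a (r : ℝ), A a + r • n = 0 → a = 0 ∧ r = 0)
    (e : Module.Basis (Fin m) ℝ (EuclideanSpace ℝ (Fin (m - 1)) × ℝ)) :
    Matrix.det (Matrix.of fun i => A (e i).1 + (e i).2 • n) ≠ 0 := by
  let T : (EuclideanSpace ℝ (Fin (m - 1)) × ℝ) →ₗ[ℝ] (Fin m → ℝ) :=
    A.coprod (LinearMap.toSpanSingleton ℝ _ n)
  have hT : LinearMap.ker T = ⊥ := by
    refine LinearMap.ker_eq_bot'.2 fun v hv => ?_
    obtain ⟨h1, h2⟩ := hinj v.1 v.2 hv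
    exact Prod.ext h1 h2
  have hli := e.linearIndependent.map' T hT
  have h3 : IsUnit (Matrix.of fun i => A (e i).1 + (e i).2 • n) :=
    Matrix.linearIndependent_rows_iff_isUnit.1 hli
  exact ((Matrix.isUnit_iff_isUnit_det _).1 h3).ne_zero

/-- The quotient `exp(i (arg w - α))` is the sign of `r`, so `sin (arg w - α) = 0`. -/
theorem argModPi_real_mul_exp {r : ℝ} (hr : r ≠ 0) (α : ℝ) :
    argModPi (r * Complex.exp (α * Complex.I)) = ((α : ℝ) : AddCircle Real.pi) := by
  set w : ℂ := r * Complex.exp (α * Complex.I) with hw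
  have h1 : ‖w‖ = |r| := by simp [hw, Complex.norm_exp]
  have h2 := Complex.norm_mul_exp_arg_mul_I w
  rw [h1] at h2
  have h3 : Complex.exp ((Complex.arg w - α : ℂ) * Complex.I) = (r / |r| : ℝ) := by
    rw [sub_mul, Complex.exp_sub, div_eq_iff (Complex.exp_ne_zero _)]
    have h4 : ((|r| : ℝ) : ℂ) ≠ 0 := by simpa using hr
    apply mul_left_cancel₀ h4
    rw [h2, hw]
    push_cast
    field_simp
  have h5 : Real.sin (Complex.arg w - α) = 0 := by
    have := congrArg Complex.im h3
    rw [← Complex.ofReal_sub, Complex.exp_ofReal_mul_I_im, Complex.ofReal_im] at this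
    exact this
  obtain ⟨k, hk⟩ := Real.sin_eq_zero_iff.1 h5
  unfold argModPi
  rw [← sub_eq_zero, ← AddCircle.coe_sub, AddCircle.coe_eq_zero_iff]
  exact ⟨k, by rw [← hk]; simp⟩

theorem addCircle_pi_eq_iff (α β : ℝ) :
    ((α : ℝ) : AddCircle Real.pi) = ((β : ℝ) : AddCircle Real.pi) ↔
      ∃ n : ℤ, α = β + n * Real.pi := by
  rw [← sub_eq_zero, ← AddCircle.coe_sub, AddCircle.coe_eq_zero_iff]
  constructor
  · rintro ⟨n, hn⟩
    exact ⟨n, by rw [zsmul_eq_mul] at hn; linarith⟩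
  · rintro ⟨n, hn⟩
    exact ⟨n, by rw [zsmul_eq_mul]; linarith⟩

end ToricCone

/-! ### The map `F` in affine charts -/

namespace ToricCone

variable {m : ℕ}

namespace ToricKahlerCone

variable {S : Type*} [TopologicalSpace S]
  [ChartedSpace (EuclideanSpace ℝ (Fin (2 * m - 1))) S] [IsManifold (𝓡 (2 * m - 1)) ∞ S]
variable (X : ToricKahlerCone m S) {t : Finset (Fin m → ℤ)}
  {b : Module.Basis (Fin m) ℤ (Fin m → ℤ)} {φ : OpenPartialHomeomorph (Cone S) (Fin m → ℂ)}

/-- The element of `ℂᵐ` whose exponential acts as the dilation by `a` followed by `exp v`. -/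
def dilRot (a : PosReal) (v : Fin m → ℝ) : Fin m → ℂ :=
  Real.log a • cplx X.reeb + Complex.I • cplx v

theorem lagMap_eq_act [T2Space S] (ζ : Fin m → ℝ) (f : ℝ → ℝ) (ρ : ℝ → PosReal) (ν : Fin m → ℝ)
    (p : Cone S) (t : ℝ) : X.lagMap ζ f ρ (torusExp ν) p t =
      X.act (complexExp (X.dilRot (ρ t) (f t • ζ + ν))) p := by
  have h1 : (ρ t) = ⟨Real.exp (Real.log (ρ t)), Real.exp_pos _⟩ :=
    Subtype.ext (Real.exp_log (ρ t).2).symm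
  have h2 : torusIncl (torusExp (f t • ζ) * torusExp ν) =
      complexExp (Complex.I • cplx (f t • ζ + ν)) := by
    rw [torusIncl_mul, torusIncl_torusExp, torusIncl_torusExp, ← complexExp_add, map_add,
      smul_add]
  rw [lagMap, h2, dilRot, act_complexExp_add, ← X.dil_exp_eq_act, ← h1]

theorem dilRot_add (a : PosReal) (v w : Fin m → ℝ) :
    X.dilRot a (v + w) = X.dilRot a v + Complex.I • cplx w := by
  simp only [dilRot, map_add, smul_add, add_assoc]

theorem injective_actDeriv (z : Fin m → ℂ) (p : Cone S) :
    Function.Injective (X.actDeriv (complexExp z) p) := by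
  obtain ⟨t, -, b, φ, h, hp⟩ := X.chart_cover p
  obtain ⟨u, hu, rfl⟩ : ∃ u ∈ φ.target, φ.symm u = p := ⟨φ p, φ.map_source hp, φ.left_inv hp⟩
  refine (injective_iff_map_eq_zero _).2 fun v hv => ?_
  have h1 := h.holomorphic.coneDeriv_chartDeriv hp v
  rw [φ.right_inv hu] at h1
  rw [← h1, X.actDeriv_coneDeriv h hu] at hv
  have h2 := h.injective_coneDeriv (h.mul_mem_target hu _) (hv.trans (map_zero _).symm)
  have h3 : chartDeriv φ (φ.symm u) v = 0 := by
    funext j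
    exact (mul_eq_zero.1 (congrFun h2 j)).resolve_left (orbitExp_ne_zero b z j)
  rw [← h1, h3, map_zero]

/-- In an affine toric chart around one of its points, a parametrization of a subset of the real
form is a smooth immersion into `ℝᵐ`. -/
theorem exists_real_parametrization [T2Space S] {ζ : Fin m → ℝ} {c : ℝ}
    (h : IsAffineToricChart X.J X.act X.base t b φ)
    {φA : OpenPartialHomeomorph (EuclideanSpace ℝ (Fin (m - 1))) (X.realLevel ζ c)}
    (hA : IsLocalParametrization (m := m) (X.realLevel ζ c) φA)
    {x : EuclideanSpace ℝ (Fin (m - 1))} (hx : x ∈ φA.source) (hxs : (φA x : Cone S) ∈ φ.source) :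
    ∃ k : EuclideanSpace ℝ (Fin (m - 1)) → Fin m → ℝ, ContDiffAt ℝ ∞ k x ∧
      (∀ᶠ y in 𝓝 x, cplx (k y) ∈ φ.target ∧ (φA y : Cone S) = φ.symm (cplx (k y))) ∧
      Function.Injective (fderiv ℝ k x) ∧
      ∀ a, X.pullOmega φ.symm (cplx (k x)) (cplx (fderiv ℝ k x a))
        (Complex.I • cplx (latCoord b ℝ ζ * k x)) = 0 := by
  have hsm : ContMDiffAt 𝓘(ℝ, EuclideanSpace ℝ (Fin (m - 1))) (coneI m) ∞
      (fun y => (φA y : Cone S)) x := hA.smooth.contMDiffAt (φA.open_source.mem_nhds hx)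
  set k : EuclideanSpace ℝ (Fin (m - 1)) → Fin m → ℝ := fun y => reVec (φ (φA y)) with hk
  have hκ : ContDiffAt ℝ ∞ (fun y => φ (φA y)) x :=
    ((h.holomorphic.contMDiffAt hxs).comp x hsm).contDiffAt
  have hks : ContDiffAt ℝ ∞ k x := reVec.contDiff.contDiffAt.comp x hκ
  have hev : ∀ᶠ y in 𝓝 x, cplx (k y) ∈ φ.target ∧ (φA y : Cone S) = φ.symm (cplx (k y)) := by
    filter_upwards [hsm.continuousAt.eventually (φ.open_source.mem_nhds hxs)] with y hy
    have h1 := X.apply_eq_cplx_of_mem_realLevel h hy (φA y).2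
    simp only [hk]
    rw [← h1]
    exact ⟨φ.map_source hy, (φ.left_inv hy).symm⟩
  have hkd : HasFDerivAt k (fderiv ℝ k x) x := (hks.differentiableAt (by simp)).hasFDerivAt
  have hV := hev.self_of_nhds.1
  refine ⟨k, hks, hev, ?_, fun a => ?_⟩
  · have hinj : Function.Injective (coneDeriv m (fun y => (φA y : Cone S)) x) := hA.immersion x hx
    rw [coneDeriv_congr (hev.mono fun y hy => hy.2)] at hinj
    refine (injective_iff_map_eq_zero _).2 fun a ha => hinj ?_
    have hcd := (cplx (m := m)).hasFDerivAt.comp x hkd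
    rw [map_zero, coneDeriv_comp (κ := fun y => cplx (k y)) (h.mdifferentiableAt_symm hV)
      hcd.differentiableAt]
    have e4 : fderiv ℝ (fun y => cplx (k y)) x a = cplx (fderiv ℝ k x a) :=
      congrArg (fun T : EuclideanSpace ℝ (Fin (m - 1)) →L[ℝ] _ => T a) hcd.fderiv
    rw [e4, ha, map_zero, map_zero]
  -- The moment component is constant along the parametrization; differentiating makes its tangent
  -- vectors ω-orthogonal to `X_ζ`.
  · set g : (Fin m → ℝ) → ℝ := fun x => X.chartMoment b φ ζ (cplx x) with hg
    have hgd : DifferentiableAt ℝ g (k x) :=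
      (((X.contDiffOn_chartMoment h ζ).contDiffAt (φ.open_target.mem_nhds hV)).differentiableAt
        (by simp)).comp _ cplx.differentiableAt
    have h1 := hgd.hasFDerivAt.comp x hkd
    have h2 : (g ∘ k) =ᶠ[𝓝 x] fun _ => 2 * c := by
      filter_upwards [hev] with y hy
      refine (X.symm_mem_realLevel_iff h hy.1 ζ c).1 ?_
      rw [← hy.2]
      exact (φA y).2
    have h3 := h1.unique ((hasFDerivAt_const (2 * c) x).congr_of_eventuallyEq h2)
    have h4 : fderiv ℝ g (k x) (fderiv ℝ k x a) = 0 :=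
      congrArg (fun T : EuclideanSpace ℝ (Fin (m - 1)) →L[ℝ] ℝ => T a) h3
    rw [hg, X.fderiv_chartMoment_cplx h hV] at h4
    linarith

/-- The rotation is taken relative to time `s`, so the factor is `1` at the base point and the
derivative splits into a real part and an imaginary multiple of `ζ · k x`. -/
theorem hasFDerivAt_rotated_parametrization (b : Module.Basis (Fin m) ℤ (Fin m → ℤ))
    {E : Type*} [NormedAddCommGroup E] [NormedSpace ℝ E] {k : E → Fin m → ℝ} {x : E}
    (hk : DifferentiableAt ℝ k x) {f : ℝ → ℝ} {s : ℝ} (hf : DifferentiableAt ℝ f s)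
    (ζ : Fin m → ℝ) :
    ∃ L : E × ℝ →L[ℝ] (Fin m → ℂ),
      HasFDerivAt (fun q : E × ℝ =>
        orbitExp b (Complex.I • cplx ((f q.2 - f s) • ζ)) * cplx (k q.1)) L (x, s) ∧
      ∀ v, L v = cplx (fderiv ℝ k x v.1) +
        (Complex.I * deriv f s * v.2) • cplx (latCoord b ℝ ζ * k x) := by
  have hf1 : HasFDerivAt (fun q : E × ℝ => f q.2 - f s)
      ((deriv f s) • (ContinuousLinearMap.snd ℝ E ℝ)) (x, s) := by
    have e1 := hf.hasDerivAt.comp_hasFDerivAt (x, s)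
      (ContinuousLinearMap.snd ℝ E ℝ).hasFDerivAt
    exact e1.sub_const (f s)
  have hI : HasFDerivAt (fun q : E × ℝ => (f q.2 - f s) • (Complex.I • cplx ζ))
      (((deriv f s) • (ContinuousLinearMap.snd ℝ E ℝ)).smulRight (Complex.I • cplx ζ)) (x, s) :=
    hf1.smul_const _
  obtain ⟨B, hB, hB'⟩ := hasFDerivAt_orbitExp b ((f s - f s) • (Complex.I • cplx ζ))
  have h1 := hB.comp (x, s) hI
  have h2 := (cplx (m := m)).hasFDerivAt.comp (x, s)
    (hk.hasFDerivAt.comp (x, s) (ContinuousLinearMap.fst ℝ E ℝ).hasFDerivAt)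
  have h3 := h1.mul h2
  refine ⟨_, h3.congr_of_eventuallyEq (Eventually.of_forall fun q => ?_), fun v => ?_⟩
  · simp only [Function.comp_apply, map_smul, Pi.mul_apply]
    rw [smul_comm]
    rfl
  · have e0 : orbitExp b 0 = 1 := by
      funext j
      simp [orbitExp]
    have e1 : (deriv f s * v.2) • (Complex.I • cplx ζ) =
        (Complex.I * deriv f s * v.2) • cplx ζ := by
      funext j
      simp
      ring
    funext j
    simp [hB', e0, e1, latCoord_cplx]
    ring_nf
    simp

end ToricKahlerCone

end ToricCone

/-! ### The Lagrangian angle and the main theorem -/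

namespace ToricCone

variable {m : ℕ}

namespace ToricAlmostCYCone

variable {S : Type*} [TopologicalSpace S]
  [ChartedSpace (EuclideanSpace ℝ (Fin (2 * m - 1))) S] [IsManifold (𝓡 (2 * m - 1)) ∞ S]
variable (X : ToricAlmostCYCone m S)

/-- Both γ and `reeb` are real, so the dilation contributes a positive factor and only the rotation
affects the phase. -/
theorem character_dilRot (a : PosReal) (v : Fin m → ℝ) :
    ∃ s : ℝ, s ≠ 0 ∧ X.character (X.dilRot a v) =
      s * Complex.exp (((∑ k, (X.gamma k : ℝ) * v k : ℝ) : ℂ) * Complex.I) := by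
  refine ⟨Real.exp (∑ k, (X.gamma k : ℝ) * (Real.log a * X.reeb k)), (Real.exp_pos _).ne', ?_⟩
  rw [Complex.ofReal_exp, ← Complex.exp_add, character]
  congr 1
  push_cast
  rw [Finset.sum_mul, ← Finset.sum_add_distrib]
  refine Finset.sum_congr rfl fun k _ => ?_
  simp [ToricKahlerCone.dilRot]
  ring

/-- The rotated real level set: in local coordinates the map is smooth, a Lagrangian immersion,
and its Lagrangian angle is determined by the character `γ`. -/
theorem lagMap_pointwise [T2Space S] (hm : 0 < m) {ζ : Fin m → ℝ} {c : ℝ}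
    (hSpan : ∀ y ∈ X.momentImage ∩ hyperplane ζ c, ζ ∉ X.zSpan y)
    {I : Set ℝ} (hIopen : IsOpen I) {f : ℝ → ℝ} (hf : ContDiffOn ℝ ∞ f I)
    (hf' : ∀ t ∈ I, deriv f t ≠ 0) {ρ : ℝ → PosReal} (hρ : ∀ s ∈ I, ∀ t ∈ I, ρ s = ρ t)
    (ν : Fin m → ℝ)
    {φA : OpenPartialHomeomorph (EuclideanSpace ℝ (Fin (m - 1))) (X.realLevel ζ c)}
    (hA : IsLocalParametrization (m := m) (X.realLevel ζ c) φA)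
    {G : EuclideanSpace ℝ (Fin (m - 1)) × ℝ → Cone S}
    (hG : ∀ q, G q = X.lagMap ζ f ρ (torusExp ν) (φA q.1) q.2)
    {x : EuclideanSpace ℝ (Fin (m - 1))} {s : ℝ} (hx : x ∈ φA.source) (hs : s ∈ I) :
    ContMDiffAt 𝓘(ℝ, EuclideanSpace ℝ (Fin (m - 1)) × ℝ) (coneI m) ∞ G (x, s) ∧
      Function.Injective (coneDeriv m G (x, s)) ∧
      (∀ v w, X.omegaB (G (x, s)) (coneDeriv m G (x, s) v) (coneDeriv m G (x, s) w) = 0) ∧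
      ∀ e : Module.Basis (Fin m) ℝ (EuclideanSpace ℝ (Fin (m - 1)) × ℝ), ∃ r : ℝ, r ≠ 0 ∧
        X.flatOmega (G (x, s)) (fun i => coneDeriv m G (x, s) (e i)) =
          r * Complex.exp (((∑ k, (X.gamma k : ℝ) * (f s * ζ k + ν k) + Real.pi / 2 : ℝ) : ℂ)
            * Complex.I) := by
  obtain ⟨t, ht, b, φ, h, hp⟩ := X.chart_cover (φA x : Cone S)
  obtain ⟨k, hks, hev, hkinj, hktan⟩ := X.exists_real_parametrization h hA hx hp
  obtain ⟨hV, hpx⟩ := hev.self_of_nhds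
  have hfs : ContDiffAt ℝ ∞ f s := hf.contDiffAt (hIopen.mem_nhds hs)
  set n : Fin m → ℝ := latCoord b ℝ ζ * k x with hn
  have hn0 : n ≠ 0 := X.latCoord_mul_ne_zero ht h hSpan hV (by rw [← hpx]; exact (φA x).2)
  set A : EuclideanSpace ℝ (Fin (m - 1)) →L[ℝ] (Fin m → ℝ) := fderiv ℝ k x with hAdef
  set z := X.dilRot (ρ s) (f s • ζ + ν) with hz
  set Q : EuclideanSpace ℝ (Fin (m - 1)) × ℝ → Fin m → ℂ := fun q =>
    orbitExp b (Complex.I • cplx ((f q.2 - f s) • ζ)) * cplx (k q.1) with hQ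
  obtain ⟨L, hL, hLv⟩ := ToricKahlerCone.hasFDerivAt_rotated_parametrization b
    (hks.differentiableAt (by simp)) (hfs.differentiableAt (by simp)) ζ
  have hQ0 : Q (x, s) = cplx (k x) := by
    funext j
    simp [hQ, orbitExp]
  have hQs : ContDiffAt ℝ ∞ Q (x, s) := by
    have e1 : ContDiffAt ℝ ∞ (fun q : EuclideanSpace ℝ (Fin (m - 1)) × ℝ => f q.2) (x, s) :=
      ContDiffAt.comp (x, s) (g := f) (f := Prod.snd) hfs contDiffAt_snd
    have e2 : ContDiffAt ℝ ∞ (fun q : EuclideanSpace ℝ (Fin (m - 1)) × ℝ => k q.1) (x, s) :=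
      ContDiffAt.comp (x, s) (g := k) (f := Prod.fst) hks contDiffAt_fst
    have e3 : ContDiff ℝ ∞ (orbitExp b) :=
      contDiff_expVec.comp (ToricKahlerCone.contDiff_latCoord b)
    have e4 : ContDiffAt ℝ ∞ (fun q : EuclideanSpace ℝ (Fin (m - 1)) × ℝ =>
        Complex.I • cplx ((f q.2 - f s) • ζ)) (x, s) :=
      (cplx.contDiff.contDiffAt.comp (x, s)
        ((e1.sub contDiffAt_const).smul contDiffAt_const)).const_smul Complex.I
    exact (e3.contDiffAt.comp (x, s) e4).mul (cplx.contDiff.contDiffAt.comp (x, s) e2)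
  -- Constancy of `ρ` allows the torus element at time `q.2` to be written as the fixed element `z`
  -- times the rotation by `(f q.2 - f s) ζ`; only the latter is differentiated.
  have hGev : G =ᶠ[𝓝 (x, s)] fun q => X.act (complexExp z) (φ.symm (Q q)) := by
    have e1 := (continuous_fst.tendsto (x, s)).eventually hev
    have e2 := (continuous_snd.tendsto (x, s)).eventually (hIopen.mem_nhds hs)
    filter_upwards [e1, e2] with q hq1 hq2
    rw [hG, X.lagMap_eq_act, hq1.2, hρ q.2 hq2 s hs, hQ]
    have e3 : f q.2 • ζ + ν = (f s • ζ + ν) + (f q.2 - f s) • ζ := by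
      rw [sub_smul]
      abel
    rw [e3, X.dilRot_add, act_complexExp_add, h.act_symm _ hq1.1]
    rfl
  have hψ : ContMDiffAt 𝓘(ℝ, Fin m → ℂ) (coneI m) ∞ φ.symm (Q (x, s)) := by
    rw [hQ0]
    exact h.holomorphic.contMDiffAt_symm hV
  have hψQ : ContMDiffAt 𝓘(ℝ, EuclideanSpace ℝ (Fin (m - 1)) × ℝ) (coneI m) ∞
      (fun q => φ.symm (Q q)) (x, s) := hψ.comp (x, s) hQs.contMDiffAt
  have hD : ∀ v, coneDeriv m G (x, s) v = X.actDeriv (complexExp z) (φ.symm (cplx (k x)))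
      (coneDeriv m φ.symm (cplx (k x)) (L v)) := fun v => by
    rw [coneDeriv_congr hGev, X.coneDeriv_act _ (hψQ.mdifferentiableAt (by simp)),
      coneDeriv_comp (hψ.mdifferentiableAt (by simp)) hL.differentiableAt, hL.fderiv]
    rw [hQ0]
  have hG0 : G (x, s) = X.act (complexExp z) (φ.symm (cplx (k x))) := by
    rw [← hQ0]
    exact hGev.self_of_nhds
  have hWpos := X.pullOmega_symm_I_pos h hV
    (a := cplx n) fun e => hn0 (cplx_injective (e.trans (map_zero _).symm))
  -- Pairing with `i n` under ω annihilates `A a` and is positive on `n`, so `n` is transverse to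
  -- the level set.
  have hindep : ∀ a (r : ℝ), A a + r • n = 0 → a = 0 ∧ r = 0 := fun a r har => by
    have e1 := congrArg (fun y => X.pullOmega φ.symm (cplx (k x)) (cplx y)
      (Complex.I • cplx n)) har
    simp only [map_add, map_smul, add_apply, smul_apply, map_zero, zero_apply] at e1
    rw [hktan a, zero_add, smul_eq_mul] at e1
    have hr : r = 0 := (mul_eq_zero.1 e1).resolve_right hWpos.ne'
    rw [hr, zero_smul, add_zero] at har
    exact ⟨hkinj (har.trans (map_zero _).symm), hr⟩
  refine ⟨?_, ?_, fun v w => ?_, fun e => ?_⟩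
  · exact ((X.act_smooth _).contMDiffAt.comp (x, s) hψQ).congr_of_eventuallyEq hGev
  · refine (injective_iff_map_eq_zero _).2 fun v hv => ?_
    rw [hD] at hv
    have e1 := X.injective_actDeriv _ _ (hv.trans (map_zero _).symm)
    have e2 := h.injective_coneDeriv hV (e1.trans (map_zero _).symm)
    rw [hLv] at e2
    have e3 : A v.1 = 0 := by
      funext j
      have := congrArg Complex.re (congrFun e2 j)
      simpa using this
    have e4 : (deriv f s * v.2) • n = 0 := by
      funext j
      have := congrArg Complex.im (congrFun e2 j)
      simpa [hn] using this
    have e5 := (smul_eq_zero.1 e4).resolve_right hn0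
    exact Prod.ext (hkinj (e3.trans (map_zero _).symm))
      ((mul_eq_zero.1 e5).resolve_left (hf' s hs))
  · have e1 := X.pullOmega_act (Real.log (ρ s)) (f s • ζ + ν) (ψ := φ.symm)
      (h.mdifferentiableAt_symm hV)
    have e2 := congrArg (fun B : (Fin m → ℂ) →L[ℝ] (Fin m → ℂ) →L[ℝ] ℝ => B (L v) (L w)) e1
    have hd := h.mdifferentiableAt_symm hV
    simp only [KahlerCone.pullOmega_apply] at e2
    rw [X.coneDeriv_act _ hd, X.coneDeriv_act _ hd] at e2
    rw [hG0, hD, hD]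
    refine e2.trans ?_
    rw [smul_apply, smul_apply]
    refine smul_eq_zero_of_right _ ?_
    have e3 : ∀ v, L v = cplx (A v.1) + (deriv f s * v.2) • (Complex.I • cplx n) := fun v => by
      rw [hLv]
      congr 1
      funext j
      simp [hn]
      ring
    have e4 : X.pullOmega φ.symm (cplx (k x)) (Complex.I • cplx n) (cplx (A w.1)) = 0 := by
      rw [X.pullOmega_anti, hktan, neg_zero]
    have e5 : X.pullOmega φ.symm (cplx (k x)) (Complex.I • cplx n) (Complex.I • cplx n) = 0 := by
      have := X.pullOmega_anti φ.symm (cplx (k x)) (Complex.I • cplx n) (Complex.I • cplx n)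
      linarith
    rw [e3, e3]
    simp only [map_add, map_smul, add_apply, smul_apply, X.pullOmega_real_real h hV, hktan, e4,
      e5, smul_zero, add_zero]
  -- At a real point the coefficient of Ω is real and the determinant is `i f'(s)` times a real
  -- number. With the character this leaves a nonzero real times `exp(i (f(s) N + θ + π/2))`.
  · obtain ⟨κ, -, hκ0, hκΩ, -, hκc⟩ := X.exists_flatOmega_eq h
    obtain ⟨κr, hκr⟩ : ∃ r : ℝ, κ (cplx (k x)) = r := by
      have e1 := hκc _ hV
      rw [conjVec_eq_self_iff.2 ⟨k x, rfl⟩] at e1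
      exact ⟨_, (Complex.conj_eq_iff_re.1 e1.symm).symm⟩
    have hκr0 : κr ≠ 0 := fun e => hκ0 _ hV (by rw [hκr, e, Complex.ofReal_zero])
    obtain ⟨a, ha0, ha⟩ := X.character_dilRot (ρ s) (f s • ζ + ν)
    set d : ℝ := Matrix.det (Matrix.of fun i => A (e i).1 + (e i).2 • n) with hd
    have hd0 : d ≠ 0 := det_add_smul_ne_zero (A := A.toLinearMap) hindep e
    have hdet : Matrix.det (Matrix.of fun i => L (e i)) = Complex.I * deriv f s * d := by
      simp only [hLv]
      exact det_add_smul hm A.toLinearMap n e (Complex.I * deriv f s)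
    refine ⟨a * κr * deriv f s * d,
      mul_ne_zero (mul_ne_zero (mul_ne_zero ha0 hκr0) (hf' s hs)) hd0, ?_⟩
    have hpi : Complex.exp (((Real.pi / 2 : ℝ) : ℂ) * Complex.I) = Complex.I := by
      push_cast
      exact Complex.exp_pi_div_two_mul_I
    rw [hG0]
    simp only [hD]
    rw [X.flatOmega_act, hκΩ _ hV, hdet, hκr, ha, Complex.ofReal_add, add_mul, Complex.exp_add,
      hpi]
    simp only [Pi.add_apply, Pi.smul_apply, smul_eq_mul]
    push_cast
    ring

end ToricAlmostCYCone

/-- Differentiating gives `cos(f N + α) · f' · N = 0`, and the cosine cannot vanish where the sine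
does. -/
theorem eq_zero_of_sin_eq_zero {I : Set ℝ} (hIopen : IsOpen I) (hIne : I.Nonempty)
    {f : ℝ → ℝ} (hf : ContDiffOn ℝ ∞ f I) (hf' : ∀ t ∈ I, deriv f t ≠ 0) {N α : ℝ}
    (h : ∀ t ∈ I, Real.sin (f t * N + α) = 0) : N = 0 := by
  obtain ⟨t, ht⟩ := hIne
  have hd := ((hf.contDiffAt (hIopen.mem_nhds ht)).differentiableAt (by simp)).hasDerivAt
  have h1 := ((hd.mul_const N).add_const α).sin
  have h2 : (fun t => Real.sin (f t * N + α)) =ᶠ[𝓝 t] fun _ => 0 := by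
    filter_upwards [hIopen.mem_nhds ht] with s hs using h s hs
  have h3 := h1.unique ((hasDerivAt_const t (0 : ℝ)).congr_of_eventuallyEq h2)
  have h4 : Real.cos (f t * N + α) ≠ 0 := fun hc => by
    have := Real.sin_sq_add_cos_sq (f t * N + α)
    rw [h t ht, hc] at this
    norm_num at this
  exact (mul_eq_zero.1 ((mul_eq_zero.1 h3).resolve_left h4)).resolve_left (hf' t ht)

end ToricCone

end

theorem mainTheorem4 (m : ℕ) (hm : 0 < m) (S : Type*) [TopologicalSpace S] [T2Space S]
    [SecondCountableTopology S] [ChartedSpace (EuclideanSpace ℝ (Fin (2 * m - 1))) S]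
    [IsManifold (𝓡 (2 * m - 1)) ∞ S]
    (X : ToricCone.ToricAlmostCYCone m S)
    (ζ : Fin m → ℝ) (c : ℝ)
    (hInt : (interior X.momentImage ∩ ToricCone.hyperplane ζ c).Nonempty)
    (hSpan : ∀ y ∈ X.momentImage ∩ ToricCone.hyperplane ζ c, ζ ∉ X.zSpan y)
    (I : Set ℝ) (hIopen : IsOpen I) (hIconn : I.OrdConnected) (hIne : I.Nonempty)
    (f : ℝ → ℝ) (hf : ContDiffOn ℝ ∞ f I) (hf' : ∀ t ∈ I, deriv f t ≠ 0)
    (ρ : ℝ → ToricCone.PosReal) (hρ : ∀ s ∈ I, ∀ t ∈ I, ρ s = ρ t)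
    (ν : Fin m → ℝ) (θ₀ : ℝ) :
    ToricCone.IsSpecialLagrangian X (X.realLevel ζ c) I
        (X.lagMap ζ f ρ (ToricCone.torusExp ν)) θ₀ ↔
      (∑ k, (X.gamma k : ℝ) * ζ k = 0 ∧
        ∃ n : ℤ, (∑ k, (X.gamma k : ℝ) * ν k) + Real.pi / 2 = θ₀ + n * Real.pi) := by
  have hsum : ∀ s, ∑ k, (X.gamma k : ℝ) * (f s * ζ k + ν k) + Real.pi / 2 =
      f s * (∑ k, (X.gamma k : ℝ) * ζ k) +
        ((∑ k, (X.gamma k : ℝ) * ν k) + Real.pi / 2) := fun s => by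
    simp only [mul_add, Finset.sum_add_distrib, Finset.mul_sum, mul_left_comm, add_assoc]
  constructor
  · rintro ⟨hemb, hsl⟩
    -- Without a point on the level set the angle condition would be vacuous.
    obtain ⟨p, hp⟩ := X.exists_mem_realLevel
      (hInt.mono (Set.inter_subset_inter_left _ interior_subset))
    obtain ⟨φA, hA, hpφ⟩ := hemb ⟨p, hp⟩
    have hx := φA.map_target hpφ
    obtain ⟨σ⟩ : Nonempty (Fin (m - 1) ⊕ Unit ≃ Fin m) :=
      Fintype.card_eq.1 (by simp; omega)
    let e : Module.Basis (Fin m) ℝ (EuclideanSpace ℝ (Fin (m - 1)) × ℝ) :=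
      ((EuclideanSpace.basisFun (Fin (m - 1)) ℝ).toBasis.prod
        (Module.Basis.singleton Unit ℝ)).reindex σ
    have hang : ∀ s ∈ I, ∃ n : ℤ, f s * (∑ k, (X.gamma k : ℝ) * ζ k) +
        ((∑ k, (X.gamma k : ℝ) * ν k) + Real.pi / 2) = θ₀ + n * Real.pi := fun s hs => by
      obtain ⟨-, -, -, h4⟩ := X.lagMap_pointwise hm hSpan hIopen hf hf' hρ ν hA
        (G := fun q => X.lagMap ζ f ρ (ToricCone.torusExp ν) (φA q.1) q.2) (fun _ => rfl) hx hs
      obtain ⟨r, hr, hre⟩ := h4 e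
      have h5 := (((hsl φA hA).2 (_, s) ⟨hx, hs⟩).2.2 e).2
      have h6 := (congrArg ToricCone.argModPi hre).symm.trans h5
      rw [ToricCone.argModPi_real_mul_exp hr, ToricCone.addCircle_pi_eq_iff, hsum] at h6
      exact h6
    -- The integer in `hang` may depend on `s`; taking the sine of the difference from `θ₀` removes
    -- it.
    have hN : ∑ k, (X.gamma k : ℝ) * ζ k = 0 :=
      ToricCone.eq_zero_of_sin_eq_zero hIopen hIne hf hf'
        (α := (∑ k, (X.gamma k : ℝ) * ν k) + Real.pi / 2 - θ₀) fun s hs => by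
          obtain ⟨n, hn⟩ := hang s hs
          refine Real.sin_eq_zero_iff.2 ⟨n, ?_⟩
          linarith
    refine ⟨hN, ?_⟩
    obtain ⟨s, hs⟩ := hIne
    have := hang s hs
    rw [hN, mul_zero, zero_add] at this
    exact this
  · rintro ⟨hN, hθ⟩
    refine ⟨X.isEmbeddedSubmanifold_realLevel hm hSpan, fun φA hA => ?_⟩
    have key := fun (x) (s : ℝ) (hx : x ∈ φA.source) (hs : s ∈ I) =>
      X.lagMap_pointwise hm hSpan hIopen hf hf' hρ ν hA
        (G := fun q => X.lagMap ζ f ρ (ToricCone.torusExp ν) (φA q.1) q.2) (fun _ => rfl) hx hs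
    refine ⟨fun q hq => (key q.1 q.2 hq.1 hq.2).1.contMDiffWithinAt, fun q hq => ?_⟩
    obtain ⟨-, h2, h3, h4⟩ := key q.1 q.2 hq.1 hq.2
    refine ⟨h2, fun v w => ?_, fun e => ?_⟩
    · exact (X.omegaB_apply _ _ _).symm.trans (h3 v w)
    · obtain ⟨r, hr, hre⟩ := h4 e
      rw [hsum, hN, mul_zero, zero_add] at hre
      refine ⟨fun h0 => ?_, ?_⟩
      · exact mul_ne_zero (Complex.ofReal_ne_zero.2 hr) (Complex.exp_ne_zero _)
          (hre.symm.trans h0)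
      · refine (congrArg ToricCone.argModPi hre).trans ?_
        rw [ToricCone.argModPi_real_mul_exp hr, ToricCone.addCircle_pi_eq_iff]
        exact hθ
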